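/- Setting. Let $\mathcal X$ be a compact metric space, $K:\mathcal X\times\mathcal X\to\mathbb R$ a Mercer kernel (continuous, symmetric, positive semidefinite), $(\mathcal H_K,\|\cdot\|_K)$ its reproducing kernel Hilbert space and $K_x=K(x,\cdot)$. Let $\rho$ be a Borel probability measure on $\mathcal X\times\mathbb R$ with marginal $\rho_X$ on $\mathcal X$ and conditional distributions $\rho(y|x)$, let $f_\rho(x)=\int y\,d\rho(y|x)$, let $\|\cdot\|_\rho$ be the norm of $L^2_{\rho_X}$, and let $L_Kf=\int_{\mathcal X}K_xf(x)\,d\rho_X(x)$ on $L^2_{\rho_X}$, a compact positive operator. Its powers $L_K^r$ are defined spectrally, and $\mathcal N(\lambda)=\mathrm{Tr}\big((\lambda I+L_K)^{-1}L_K\big)$ for $\lambda>0$. For $\sigma$-fields $\mathcal J,\mathcal K$ on a probability space $(\Omega,P)$ put $\alpha(\mathcal J,\mathcal K)=\sup_{A\in\mathcal J,B\in\mathcal K}|P(A\cap B)-P(A)P(B)|$. A sequence $(z_t)_{t\ge1}$ of random variables is strong mixing with coefficients $\alpha_j=\sup_{k\ge1}\alpha\big(\sigma(z_1,\dots,z_k),\sigma(z_{k+j},z_{k+j+1},\dots)\big)$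 if $\alpha_j\to0$ as $j\to\infty$. It is stationary if $(z_t,\dots,z_{t+i})$ and $(z_{t+j},\dots,z_{t+i+j})$ have the same distribution for all $t\ge 1$ and $i,j\ge 0$. Theorem. Let $\delta>0$, $0<s\le1$, $\tfrac12\le r\le1$ with $2r+s\ge2$. Assume that $|y|\le M$ $\rho$-almost surely for some $M>0$; that $\mathcal N(\lambda)\le C_0\lambda^{-s}$ for all $\lambda>0$, with a constant $C_0\ge1$; and that $f_\rho=L_K^rh_\rho$ for some $h_\rho\in L^2_{\rho_X}$. Then there is a constant $\hat C>0$ such that the following holds for every stationary strong mixing sequence $z_t=(x_t,y_t)\in\mathcal X\times\mathbb R$, $t\ge1$, in which each $z_t$ has distribution $\rho$, with strong mixing coefficients $\alpha_j$, and for every sample size $|D|\ge1$, where $D=(z_1,\dots,z_{|D|})$. With $\lambda=|D|^{-1/(2r+s)}$ and $$f_{D,\lambda}=\arg\min_{f\in\mathcal H_K}\Big\{\frac1{|D|}\sum_{(x,y)\in D}(f(x)-y)^2+\lambda\|f\|_K^2\Big\},$$ the random variable $\|f_{D,\lambda}-f_\rho\|_\rho$ is measurable (up to null sets) and $$E\big[\|f_{D,\lambda}-f_\rho\|_\rho\big]\le\hat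 C\,|D|^{-\frac r{2r+s}}\Big(1+\sum_{\ell=1}^{|D|}\sqrt{\alpha_\ell}\Big)\Big(1+|D|^{\frac{2s+\delta+2\delta r+4r}{(2r+s)(2\delta+4)}}\sum_{\ell=1}^{|D|}\alpha_\ell^{\frac{\delta}{4+2\delta}}\Big).$$ In particular $\hat C$ is independent of $|D|$. -/

import Mathlib

open MeasureTheory Filter Topology
open scoped ENNReal

namespace KRRMixing

noncomputable section

/-! ### Strong mixing sequences

A random sequence `z₁, z₂, …` is written `z : ℕ → Ω → Z`, with `z 0` for its first term. -/

section Mixing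

variable {Ω Z : Type*} [MeasurableSpace Ω] [MeasurableSpace Z]

/-- Stationarity: for all `t, i, j` the random vectors `(z_t, …, z_{t+i})` and
`(z_{t+j}, …, z_{t+i+j})` have the same distribution. -/
def IsStationary (P : Measure Ω) (z : ℕ → Ω → Z) : Prop :=
  ∀ t i j : ℕ,
    P.map (fun ω (k : Fin (i + 1)) => z (t + k) ω) =
      P.map (fun ω (k : Fin (i + 1)) => z (t + j + k) ω)

/-- The `α`-coefficient of two `σ`-fields:
`sup {|P(A ∩ B) - P(A) P(B)| : A ∈ 𝒥, B ∈ 𝒦}`. -/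
def alphaCoeff (P : Measure Ω) (J K : MeasurableSpace Ω) : ℝ :=
  ⨆ (A : {A : Set Ω // MeasurableSet[J] A}) (B : {B : Set Ω // MeasurableSet[K] B}),
    |P.real (A.1 ∩ B.1) - P.real A.1 * P.real B.1|

/-- The `σ`-field generated by the variables `z i` with `i ∈ I`. -/
@[reducible] def sigmaField (z : ℕ → Ω → Z) (I : Set ℕ) : MeasurableSpace Ω :=
  ⨆ i ∈ I, MeasurableSpace.comap (z i) inferInstance

/-- The strong mixing coefficient `α_j = sup_k α(𝓜_{1,k}, 𝓜_{k+j,∞})`. -/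
def alphaMixing (P : Measure Ω) (z : ℕ → Ω → Z) (j : ℕ) : ℝ :=
  ⨆ k : ℕ, alphaCoeff P (sigmaField z (Set.Iic k)) (sigmaField z (Set.Ici (k + j)))

/-- The strong mixing (`α`-mixing) condition `α_j → 0`. -/
def IsStrongMixing (P : Measure Ω) (z : ℕ → Ω → Z) : Prop :=
  Tendsto (alphaMixing P z) atTop (𝓝 0)

end Mixing

/-! ### Mercer kernels, integral operators, effective dimension -/

section Kernel

variable {X : Type*} [MetricSpace X] [CompactSpace X]

/-- A Mercer kernel: continuous (bundled), symmetric and positive semidefinite. -/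
structure IsMercerKernel (K : C(X × X, ℝ)) : Prop where
  symm : ∀ x y, K (x, y) = K (y, x)
  posSemidef : ∀ (n : ℕ) (x : Fin n → X) (c : Fin n → ℝ),
    0 ≤ ∑ i, ∑ j, c i * c j * K (x i, x j)

variable [MeasurableSpace X] [BorelSpace X]

/-- The class in `L²(μ)` of the function `K_x = K(x, ·)`. -/
def kernelLp (K : C(X × X, ℝ)) (μ : Measure X) [IsFiniteMeasure μ] (x : X) : Lp ℝ 2 μ :=
  ContinuousMap.toLp 2 μ ℝ (K.curry x)

lemma continuous_kernelLp (K : C(X × X, ℝ)) (μ : Measure X) [IsFiniteMeasure μ] :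
    Continuous (kernelLp K μ) :=
  (ContinuousMap.toLp 2 μ ℝ).continuous.comp K.curry.continuous

lemma exists_kernelLp_bound (K : C(X × X, ℝ)) (μ : Measure X) [IsFiniteMeasure μ] :
    ∃ C, ∀ x, ‖kernelLp K μ x‖ ≤ C := by
  obtain ⟨C, hC⟩ := (isCompact_range (continuous_kernelLp K μ)).isBounded.exists_norm_le
  exact ⟨C, fun x => hC _ ⟨x, rfl⟩⟩

lemma integrable_smul_kernelLp (K : C(X × X, ℝ)) (μ : Measure X) [IsFiniteMeasure μ]
    (f : Lp ℝ 2 μ) : Integrable (fun x => f x • kernelLp K μ x) μ := by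
  obtain ⟨C, hC⟩ := exists_kernelLp_bound K μ
  have hf : Integrable f μ := (Lp.memLp f).integrable (by norm_num)
  exact hf.smul_bdd C (continuous_kernelLp K μ).aestronglyMeasurable
    (Eventually.of_forall hC)

lemma exists_integralOp_bound (K : C(X × X, ℝ)) (μ : Measure X) [IsFiniteMeasure μ] :
    ∃ C, ∀ f : Lp ℝ 2 μ, ‖∫ x, f x • kernelLp K μ x ∂μ‖ ≤ C * ‖f‖ := by
  obtain ⟨C, hC⟩ := exists_kernelLp_bound K μ
  refine ⟨|C| * μ.real Set.univ ^ (1 / 2 : ℝ), fun f => ?_⟩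
  have hf1 : MemLp f 1 μ := (Lp.memLp f).mono_exponent (by norm_num)
  have hf : Integrable f μ := memLp_one_iff_integrable.1 hf1
  have h1 : ∫ x, ‖f x‖ ∂μ ≤ ‖f‖ * μ.real Set.univ ^ (1 / 2 : ℝ) := by
    have h2 := eLpNorm_le_eLpNorm_mul_rpow_measure_univ (p := 1) (q := 2) (μ := μ)
      (by norm_num) (Lp.memLp f).1
    have h3 : (1 / (1 : ℝ≥0∞).toReal - 1 / (2 : ℝ≥0∞).toReal) = 1 / 2 := by norm_num
    rw [h3] at h2
    have h4 := ENNReal.toReal_mono (ENNReal.mul_ne_top (Lp.eLpNorm_ne_top f)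
      (ENNReal.rpow_ne_top_of_nonneg (by norm_num) (measure_ne_top _ _))) h2
    rw [ENNReal.toReal_mul, ← ENNReal.toReal_rpow, ← Lp.norm_def] at h4
    rwa [integral_norm_eq_lintegral_enorm hf.1, ← eLpNorm_one_eq_lintegral_enorm]
  calc ‖∫ x, f x • kernelLp K μ x ∂μ‖ ≤ ∫ x, ‖f x • kernelLp K μ x‖ ∂μ :=
        norm_integral_le_integral_norm _
    _ ≤ ∫ x, |C| * ‖f x‖ ∂μ := by
        refine integral_mono (integrable_smul_kernelLp K μ f).norm (hf.norm.const_mul _) ?_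
        intro x
        simp only [norm_smul]
        rw [mul_comm]
        exact mul_le_mul_of_nonneg_right ((hC x).trans (le_abs_self C)) (norm_nonneg _)
    _ = |C| * ∫ x, ‖f x‖ ∂μ := integral_const_mul _ _
    _ ≤ |C| * (‖f‖ * μ.real Set.univ ^ (1 / 2 : ℝ)) :=
        mul_le_mul_of_nonneg_left h1 (abs_nonneg C)
    _ = _ := by ring

/-- The integral operator `L_K f = ∫ K_x f(x) dμ(x)` on `L²(μ)`. -/
def integralOp (K : C(X × X, ℝ)) (μ : Measure X) [IsFiniteMeasure μ] :
    Lp ℝ 2 μ →L[ℝ] Lp ℝ 2 μ :=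
  LinearMap.mkContinuousOfExistsBound
    { toFun := fun f => ∫ x, f x • kernelLp K μ x ∂μ
      map_add' := fun f g => by
        rw [← integral_add (integrable_smul_kernelLp K μ f) (integrable_smul_kernelLp K μ g)]
        refine integral_congr_ae ?_
        filter_upwards [Lp.coeFn_add f g] with x hx
        rw [hx, Pi.add_apply, add_smul]
      map_smul' := fun c f => by
        rw [RingHom.id_apply, ← integral_smul]
        refine integral_congr_ae ?_
        filter_upwards [Lp.coeFn_smul c f] with x hx
        rw [hx, Pi.smul_apply, smul_assoc] }
    (exists_integralOp_bound K μ)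

/-- The power `L_K^r` of the compact positive operator `L_K` on `L²(μ)`, by its spectral
decomposition: `L_K^r h = ∑_t t^r P_t h`, where `P_t` is the orthogonal projection onto
`ker (L_K - t)` (which vanishes unless `t` is an eigenvalue). -/
def integralOpPow (K : C(X × X, ℝ)) (μ : Measure X) [IsFiniteMeasure μ] (r : ℝ)
    (h : Lp ℝ 2 μ) : Lp ℝ 2 μ :=
  ∑' t : ℝ, t ^ r •
    (integralOp K μ - t • ContinuousLinearMap.id ℝ (Lp ℝ 2 μ)).ker.starProjection h

/-- The trace `∑ᵢ ⟪bᵢ, A bᵢ⟫ ∈ [0, ∞]` of a positive operator `A` on a Hilbert space, where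
`(bᵢ)` is a Hilbert basis (the value does not depend on which one). -/
def trace {E : Type*} [NormedAddCommGroup E] [InnerProductSpace ℝ E] [CompleteSpace E]
    (A : E →L[ℝ] E) : ℝ≥0∞ :=
  ∑' i : (exists_hilbertBasis ℝ E).choose,
    ENNReal.ofReal (inner ℝ (i : E) (A (i : E)))

/-- The effective dimension `𝒩(lam) = Tr((lam I + L_K)⁻¹ L_K)`. -/
def effectiveDim (K : C(X × X, ℝ)) (μ : Measure X) [IsFiniteMeasure μ] (lam : ℝ) : ℝ≥0∞ :=
  trace (Ring.inverse (lam • (1 : Lp ℝ 2 μ →L[ℝ] Lp ℝ 2 μ) + integralOp K μ) * integralOp K μ)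

end Kernel

/-! ### Regression function and kernel ridge regression -/

/-- The regression function `f_ρ(x) = ∫ y dρ(y|x)`. -/
def regressionFn {X : Type*} [MeasurableSpace X] (ρ : Measure (X × ℝ)) [IsFiniteMeasure ρ]
    (x : X) : ℝ :=
  ∫ y, y ∂(ρ.condKernel x)

section KRR

variable {X : Type*} {H : Type*} [NormedAddCommGroup H] [InnerProductSpace ℝ H]
  [RKHS ℝ H X ℝ]

/-- The regularized empirical risk `|D|⁻¹ ∑_{(x,y) ∈ D} (f(x) - y)² + lam ‖f‖_K²`. -/
def regRisk {n : ℕ} (D : Fin n → X × ℝ) (lam : ℝ) (f : H) : ℝ :=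
  (1 / (n : ℝ)) * ∑ i, (f (D i).1 - (D i).2) ^ 2 + lam * ‖f‖ ^ 2

/-- The regularized empirical risk has exactly one minimizer. -/
theorem existsUnique_regRisk_minimizer [CompleteSpace H] {n : ℕ} (D : Fin n → X × ℝ)
    {lam : ℝ} (hlam : 0 < lam) :
    ∃! f : H, ∀ g : H, regRisk D lam f ≤ regRisk D lam g := by
  let ev : Fin n → H →L[ℝ] ℝ := fun i => innerSL ℝ (RKHS.kerFun H (D i).1 1)
  have hev : ∀ i (f : H), ev i f = f (D i).1 := fun i f => by
    simp only [ev, innerSL_apply_apply, RKHS.kerFun_inner]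
    simp
  let B : H →L[ℝ] H →L[ℝ] ℝ :=
    lam • (show H →L[ℝ] H →L[ℝ] ℝ from innerSL ℝ) + (1 / (n : ℝ)) • ∑ i, (ev i).smulRight (ev i)
  have hB : ∀ f g : H, B f g =
      lam * inner ℝ f g + (1 / (n : ℝ)) * ∑ i, f (D i).1 * g (D i).1 := fun f g => by
    simp [B, hev]
    exact Or.inl rfl
  have hn : 0 ≤ 1 / (n : ℝ) := by positivity
  have hco : IsCoercive B := by
    refine ⟨lam, hlam, fun f => ?_⟩
    rw [hB, real_inner_self_eq_norm_mul_norm, mul_assoc]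
    exact le_add_of_nonneg_right
      (mul_nonneg hn (Finset.sum_nonneg fun i _ => mul_self_nonneg _))
  let v : H := (1 / (n : ℝ)) • ∑ i, (D i).2 • RKHS.kerFun H (D i).1 1
  have hv : ∀ g : H, inner ℝ v g = (1 / (n : ℝ)) * ∑ i, (D i).2 * g (D i).1 := fun g => by
    have := fun i => hev i g
    simp only [ev, innerSL_apply_apply] at this
    simp only [v, inner_smul_left, sum_inner, this]
    simp
  let f₀ : H := hco.continuousLinearEquivOfBilin.symm v
  have hf₀ : ∀ g, B f₀ g = inner ℝ v g := fun g => by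
    rw [← IsCoercive.continuousLinearEquivOfBilin_apply hco]
    simp [f₀]
  have key : ∀ g : H, regRisk D lam f₀ + lam * ‖g - f₀‖ ^ 2 ≤ regRisk D lam g := fun g => by
    obtain ⟨k, rfl⟩ : ∃ k, g = f₀ + k := ⟨g - f₀, by abel⟩
    have h1 := hf₀ k
    rw [hB, hv] at h1
    have h2 : regRisk D lam (f₀ + k) = regRisk D lam f₀ + lam * ‖k‖ ^ 2 +
        (1 / (n : ℝ)) * ∑ i, (k (D i).1) ^ 2 +
        2 * (lam * inner ℝ f₀ k + (1 / (n : ℝ)) * ∑ i, f₀ (D i).1 * k (D i).1 -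
          (1 / (n : ℝ)) * ∑ i, (D i).2 * k (D i).1) := by
      have h3 : ∑ i, ((f₀ + k) (D i).1 - (D i).2) ^ 2 =
          ∑ i, (f₀ (D i).1 - (D i).2) ^ 2 + ∑ i, (k (D i).1) ^ 2 +
          2 * (∑ i, f₀ (D i).1 * k (D i).1 - ∑ i, (D i).2 * k (D i).1) := by
        rw [← Finset.sum_sub_distrib, Finset.mul_sum, ← Finset.sum_add_distrib,
          ← Finset.sum_add_distrib]
        refine Finset.sum_congr rfl fun i _ => ?_
        rw [RKHS.coe_add, Pi.add_apply]
        ring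
      simp only [regRisk]
      rw [h3, norm_add_sq_real]
      ring
    have h4 : 0 ≤ (1 / (n : ℝ)) * ∑ i, (k (D i).1) ^ 2 :=
      mul_nonneg hn (Finset.sum_nonneg fun i _ => sq_nonneg _)
    rw [h2, add_sub_cancel_left]
    linarith
  refine ⟨f₀, fun g => le_trans (le_add_of_nonneg_right (by positivity)) (key g), ?_⟩
  intro g hg
  have h1 := key g
  have h2 := hg f₀
  have h3 : ‖g - f₀‖ ^ 2 ≤ 0 := by
    by_contra h
    have := mul_pos hlam (not_le.1 h)
    linarith
  have h4 : ‖g - f₀‖ = 0 := by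
    have := sq_nonneg ‖g - f₀‖
    exact pow_eq_zero_iff (two_ne_zero) |>.1 (le_antisymm h3 this)
  exact sub_eq_zero.1 (norm_eq_zero.1 h4)

variable (H) in
/-- The kernel ridge regression estimator `f_{D,lam} = argmin_{f ∈ H} regRisk D lam f`. -/
def krr {n : ℕ} (D : Fin n → X × ℝ) (lam : ℝ) : H :=
  Classical.epsilon fun f : H => ∀ g : H, regRisk D lam f ≤ regRisk D lam g

lemma krr_spec [CompleteSpace H] {n : ℕ} (D : Fin n → X × ℝ) {lam : ℝ} (hlam : 0 < lam)
    (g : H) : regRisk D lam (krr H D lam) ≤ regRisk D lam g :=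
  Classical.epsilon_spec (existsUnique_regRisk_minimizer (H := H) D hlam).exists g

end KRR

end

end KRRMixing

/-! Let `I` be the inclusion of `H` into `L²`, so that `L_K = I I†` (`integralOp_eq`), put `R = (lam
+ I I†)⁻¹`, and let `g = I† R f_ρ` be the population ridge solution. The error splits into a bias `I
g - f_ρ` and a sampling part `I u`, where `u = krr - g`.

Bias: `I g - f_ρ = -lam R f_ρ`. The source condition bounds it by `lam ^ r ‖h‖`, and for `r ≥ 1/2`
it also bounds `‖g‖` independently of `lam`, so that `y - g(x)` is bounded.

Sampling part: `u` solves the empirical normal equation `(T_D + lam) u = residual`. The residual is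
the centred empirical mean of `(y - g(x)) K_x`. By the resolvent identity (`inclusion_krr_sub`), `I
u = R I residual - R I (T_D - I† I) u`. The last term is at most the Hilbert–Schmidt norm of `R I
(T_D - I† I)` times `‖u‖`, and `‖u‖ ≤ ‖residual‖ / lam` since `T_D ≥ 0`. Three squared norms remain,
each that of a centred empirical mean of a bounded Hilbert-space valued function; Cauchy–Schwarz
separates the product of two of them in expectation.

Such a mean has second moment at most `n⁻¹ (V + 784 B² ∑ α_l)`, with `V` bounding the second moment
and `B` the norm (`lintegral_tsum_sq_empirical_le`). This needs a covariance inequality for vectors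
whose constant does not depend on the dimension. It follows from the scalar one by random signs,
truncation and a self-improving bound (`VectorCovarianceBound.halve`). For the functions preceded by
`R I`, `V` is controlled by the effective dimension and `B²` by a multiple of `1/lam`. With `lam ^
(2r+s) = 1/n`, elementary comparison of exponents gives the rate (`rate_bound`); `2r + s ≥ 2` enters
through `1/n ≤ lam²`. -/

namespace KRRMixing

open ProbabilityTheory

/-! ### Scalar covariance inequality under strong mixing. -/

section Covariance

variable {Ω : Type*} {mΩ : MeasurableSpace Ω} {P : Measure Ω} [IsProbabilityMeasure P]

lemma memLp_of_abs_le {m : MeasurableSpace Ω} (hm : m ≤ mΩ) {U : Ω → ℝ} {a : ℝ}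
    (hU : Measurable[m] U) (ha : ∀ ω, |U ω| ≤ a) (p : ℝ≥0∞) : MemLp U p P :=
  (MemLp.of_bound (p := ⊤) (hU.mono hm le_rfl).aestronglyMeasurable a
    (Eventually.of_forall ha)).mono_exponent le_top

lemma covariance_eq_integral_mul_condExp {m : MeasurableSpace Ω} (hm : m ≤ mΩ) {U V : Ω → ℝ}
    {a : ℝ} (hU : Measurable[m] U) (ha : ∀ ω, |U ω| ≤ a) (hV : Integrable V P) :
    cov[U, V; P] = ∫ ω, U ω * P[fun ω => V ω - P[V] | m] ω ∂P := by
  have hW : Integrable (fun ω => V ω - P[V]) P := hV.sub (integrable_const _)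
  have hUW : Integrable (fun ω => U ω * (V ω - P[V])) P :=
    hW.bdd_mul (hU.mono hm le_rfl).aestronglyMeasurable (Eventually.of_forall ha)
  have h1 : cov[U, V; P] = ∫ ω, U ω * (V ω - P[V]) ∂P := by
    rw [covariance]
    simp_rw [sub_mul]
    rw [integral_sub hUW (hW.const_mul _), integral_const_mul, integral_sub hV (integrable_const _)]
    simp
  rw [h1, ← integral_condExp hm]
  refine integral_congr_ae ?_
  exact condExp_mul_of_stronglyMeasurable_left hU.stronglyMeasurable hUW hW

/-- The `±1`-valued function that is `1` exactly on `A`. -/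
noncomputable def signOn (A : Set Ω) (ω : Ω) : ℝ := A.indicator (fun _ => 2) ω - 1

lemma abs_signOn_le (A : Set Ω) (ω : Ω) : |signOn A ω| ≤ 1 := by
  by_cases h : ω ∈ A <;> simp [signOn, h] <;> norm_num

lemma measurable_signOn {m : MeasurableSpace Ω} {A : Set Ω} (hA : MeasurableSet[m] A) :
    Measurable[m] (signOn A) :=
  (measurable_const.indicator hA).sub_const _

/-- Among `m`-measurable functions bounded by `a`, the covariance with `V` is largest for `a` times
the sign of the conditional expectation of `V - P[V]`. Used once on each side, this reduces bounded
functions to a pair of events. -/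
lemma exists_abs_covariance_le_signOn {m : MeasurableSpace Ω} (hm : m ≤ mΩ) {U V : Ω → ℝ} {a : ℝ}
    (hU : Measurable[m] U) (ha : ∀ ω, |U ω| ≤ a) (hV : Integrable V P) :
    ∃ A, MeasurableSet[m] A ∧ |cov[U, V; P]| ≤ a * cov[signOn A, V; P] := by
  set g := P[fun ω => V ω - P[V] | m] with hg
  have hgm : Measurable[m] g := stronglyMeasurable_condExp.measurable
  refine ⟨{ω | 0 ≤ g ω}, measurableSet_le measurable_const hgm, ?_⟩
  have hA : MeasurableSet[m] {ω | 0 ≤ g ω} := measurableSet_le measurable_const hgm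
  have hgi : Integrable g P := integrable_condExp
  rw [covariance_eq_integral_mul_condExp hm hU ha hV,
    covariance_eq_integral_mul_condExp hm (measurable_signOn hA) (abs_signOn_le _) hV, ← hg,
    ← integral_const_mul]
  refine (abs_integral_le_integral_abs).trans (integral_mono ?_ ?_ fun ω => ?_)
  · exact (hgi.bdd_mul (hU.mono hm le_rfl).aestronglyMeasurable (Eventually.of_forall ha)).abs
  · exact (hgi.bdd_mul ((measurable_signOn hA).mono hm le_rfl).aestronglyMeasurable
      (Eventually.of_forall (abs_signOn_le _))).const_mul _
  · have h2 : signOn {ω | 0 ≤ g ω} ω * g ω = |g ω| := by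
      by_cases h : 0 ≤ g ω
      · simp [signOn, h, abs_of_nonneg h]; ring
      · simp [signOn, h, abs_of_neg (not_le.1 h)]
    simp only [h2, abs_mul]
    exact mul_le_mul_of_nonneg_right (ha ω) (abs_nonneg _)

/-- Covariance inequality for bounded functions that are measurable with respect to two
`σ`-fields whose `α`-coefficient is at most `α`. -/
lemma abs_covariance_le_of_bounded {J K : MeasurableSpace Ω} (hJ : J ≤ mΩ) (hK : K ≤ mΩ) {α : ℝ}
    (hα : ∀ A B, MeasurableSet[J] A → MeasurableSet[K] B →
      |P.real (A ∩ B) - P.real A * P.real B| ≤ α)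
    {U V : Ω → ℝ} {a b : ℝ} (hU : Measurable[J] U) (ha : ∀ ω, |U ω| ≤ a)
    (hV : Measurable[K] V) (hb : ∀ ω, |V ω| ≤ b) :
    |cov[U, V; P]| ≤ 4 * α * a * b := by
  obtain ⟨ω₀⟩ : Nonempty Ω := P.nonempty_of_neZero
  have ha0 : 0 ≤ a := (abs_nonneg _).trans (ha ω₀)
  have hb0 : 0 ≤ b := (abs_nonneg _).trans (hb ω₀)
  obtain ⟨A, hA, h1⟩ := exists_abs_covariance_le_signOn hJ hU ha
    ((memLp_of_abs_le (P := P) hK hV hb 1).integrable le_rfl)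
  obtain ⟨B, hB, h2⟩ := exists_abs_covariance_le_signOn hK hV hb
    ((memLp_of_abs_le (P := P) hJ (measurable_signOn hA) (abs_signOn_le A) 1).integrable le_rfl)
  have hA' := hJ _ hA
  have hB' := hK _ hB
  have hiA : MemLp (A.indicator (fun _ => (2 : ℝ))) 2 P :=
    (memLp_const 2).indicator hA'
  have hiB : MemLp (B.indicator (fun _ => (2 : ℝ))) 2 P :=
    (memLp_const 2).indicator hB'
  -- The factor 4 appears because each sign function is twice an indicator, up to an additive
  -- constant.
  have h3 : cov[signOn B, signOn A; P] = 4 * (P.real (A ∩ B) - P.real A * P.real B) := by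
    have e1 : cov[signOn B, signOn A; P] =
        cov[B.indicator (fun _ => (2 : ℝ)), A.indicator (fun _ => (2 : ℝ)); P] := by
      unfold signOn
      rw [covariance_sub_const_left (hiB.integrable (by norm_num)),
        covariance_sub_const_right (hiA.integrable (by norm_num))]
    rw [e1, covariance_eq_sub hiB hiA]
    have e2 : (B.indicator (fun _ => (2 : ℝ)) * A.indicator (fun _ => (2 : ℝ))) =
        (A ∩ B).indicator (fun _ => (4 : ℝ)) := by
      ext ω
      by_cases h : ω ∈ A <;> by_cases h' : ω ∈ B <;> simp [h, h'] <;> norm_num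
    rw [e2, integral_indicator_const _ (hA'.inter hB'), integral_indicator_const _ hA',
      integral_indicator_const _ hB']
    simp only [smul_eq_mul]
    ring
  have h4 : cov[signOn B, signOn A; P] ≤ 4 * α := by
    rw [h3]
    linarith [(le_abs_self _).trans (hα A B hA hB)]
  have h5 : cov[signOn A, V; P] ≤ b * (4 * α) := by
    rw [covariance_comm]
    exact (le_abs_self _).trans (h2.trans (mul_le_mul_of_nonneg_left h4 hb0))
  calc |cov[U, V; P]| ≤ a * (b * (4 * α)) := h1.trans (mul_le_mul_of_nonneg_left h5 ha0)
    _ = _ := by ring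

end Covariance

/-! ### Second and fourth moments of Rademacher sums. -/

section Rademacher

variable {ι : Type*} [Fintype ι] [DecidableEq ι]

/-- The sign attached to a Boolean. -/
def boolSign (b : Bool) : ℝ := if b then 1 else -1

lemma boolSign_not (b : Bool) : boolSign (!b) = -boolSign b := by cases b <;> simp [boolSign]

lemma boolSign_mul_self (b : Bool) : boolSign b * boolSign b = 1 := by cases b <;> simp [boolSign]

/-- The sum over all sign patterns of a function odd in one coordinate vanishes. -/
lemma sum_sign_eq_zero (k : ι) (f : (ι → Bool) → ℝ)
    (hf : ∀ τ, f (Function.update τ k (!(τ k))) = -f τ) : ∑ τ, f τ = 0 := by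
  have hinv : Function.Involutive (fun τ : ι → Bool => Function.update τ k (!(τ k))) := by
    intro τ
    simp
  have h : ∑ τ, f τ = ∑ τ, -f τ := by
    rw [← Equiv.sum_comp hinv.toPerm f]
    exact Finset.sum_congr rfl fun τ _ => hf τ
  rw [Finset.sum_neg_distrib] at h
  linarith

lemma sum_insert_update (s : Finset ι) {k : ι} (hk : k ∉ s) (x : ι → ℝ) (τ : ι → Bool) (b : Bool) :
    ∑ i ∈ s, boolSign (Function.update τ k b i) * x i = ∑ i ∈ s, boolSign (τ i) * x i := by
  refine Finset.sum_congr rfl fun i hi => ?_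
  rw [Function.update_of_ne (by rintro rfl; exact hk hi)]

/-- Independent signs are orthonormal. When a coordinate is added, the cross terms are odd in its
sign and cancel. -/
lemma sum_sign_mul_sum (s : Finset ι) (x y : ι → ℝ) :
    ∑ τ : ι → Bool, (∑ i ∈ s, boolSign (τ i) * x i) * (∑ i ∈ s, boolSign (τ i) * y i) =
      Fintype.card (ι → Bool) * ∑ i ∈ s, x i * y i := by
  induction s using Finset.induction_on with
  | empty => simp
  | insert k s hk ih =>
    have h1 : ∑ τ : ι → Bool, boolSign (τ k) * ∑ i ∈ s, boolSign (τ i) * x i = 0 :=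
      sum_sign_eq_zero k _ fun τ => by
        rw [sum_insert_update s hk, Function.update_self, boolSign_not]; ring
    have h2 : ∑ τ : ι → Bool, boolSign (τ k) * ∑ i ∈ s, boolSign (τ i) * y i = 0 :=
      sum_sign_eq_zero k _ fun τ => by
        rw [sum_insert_update s hk, Function.update_self, boolSign_not]; ring
    have h3 : ∀ τ : ι → Bool, (∑ i ∈ insert k s, boolSign (τ i) * x i) *
        (∑ i ∈ insert k s, boolSign (τ i) * y i) = x k * y k +
        y k * (boolSign (τ k) * ∑ i ∈ s, boolSign (τ i) * x i) +
        x k * (boolSign (τ k) * ∑ i ∈ s, boolSign (τ i) * y i) +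
        (∑ i ∈ s, boolSign (τ i) * x i) * (∑ i ∈ s, boolSign (τ i) * y i) := fun τ => by
      rw [Finset.sum_insert hk, Finset.sum_insert hk]
      linear_combination x k * y k * boolSign_mul_self (τ k)
    simp_rw [h3, Finset.sum_add_distrib, ← Finset.mul_sum]
    rw [h1, h2, ih, Finset.sum_insert hk]
    simp
    ring

/-- Khintchine's inequality for the exponent 4. Odd powers of the new sign cancel, and `x⁴ + 6 x² S
+ 3 S² ≤ 3 (x² + S)²`, where `S` is the previous sum of squares, closes the induction. -/
lemma sum_sign_pow_four_le (s : Finset ι) (x : ι → ℝ) :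
    ∑ τ : ι → Bool, (∑ i ∈ s, boolSign (τ i) * x i) ^ 4 ≤
      Fintype.card (ι → Bool) * (3 * (∑ i ∈ s, x i ^ 2) ^ 2) := by
  induction s using Finset.induction_on with
  | empty => simp
  | insert k s hk ih =>
    set S : (ι → Bool) → ℝ := fun τ => ∑ i ∈ s, boolSign (τ i) * x i with hS
    have h1 : ∑ τ : ι → Bool, boolSign (τ k) * S τ = 0 :=
      sum_sign_eq_zero k _ fun τ => by
        simp only [hS]
        rw [sum_insert_update s hk, Function.update_self, boolSign_not]; ring
    have h2 : ∑ τ : ι → Bool, boolSign (τ k) * S τ ^ 3 = 0 :=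
      sum_sign_eq_zero k _ fun τ => by
        simp only [hS]
        rw [sum_insert_update s hk, Function.update_self, boolSign_not]; ring
    have h3 : ∑ τ : ι → Bool, S τ ^ 2 = Fintype.card (ι → Bool) * ∑ i ∈ s, x i ^ 2 := by
      have := sum_sign_mul_sum s x x
      simp only [← sq] at this
      exact this
    have h4 : ∀ τ : ι → Bool, (∑ i ∈ insert k s, boolSign (τ i) * x i) ^ 4 = x k ^ 4 +
        6 * x k ^ 2 * S τ ^ 2 + S τ ^ 4 + 4 * x k * (boolSign (τ k) * S τ ^ 3) +
        4 * x k ^ 3 * (boolSign (τ k) * S τ) := fun τ => by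
      rw [Finset.sum_insert hk]
      have hb := boolSign_mul_self (τ k)
      have hb2 : boolSign (τ k) ^ 2 = 1 := by rw [sq, hb]
      have hb3 : boolSign (τ k) ^ 3 = boolSign (τ k) := by rw [pow_succ, hb2, one_mul]
      have hb4 : boolSign (τ k) ^ 4 = 1 := by rw [pow_succ, hb3, hb]
      change (boolSign (τ k) * x k + S τ) ^ 4 = _
      linear_combination x k ^ 4 * hb4 + 4 * x k ^ 3 * S τ * hb3 + 6 * x k ^ 2 * S τ ^ 2 * hb2
    simp_rw [h4, Finset.sum_add_distrib, ← Finset.mul_sum]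
    rw [h1, h2, h3, Finset.sum_insert hk]
    simp only [Finset.sum_const, Finset.card_univ, nsmul_eq_mul]
    have hc : (0 : ℝ) ≤ Fintype.card (ι → Bool) := Nat.cast_nonneg _
    nlinarith [mul_nonneg hc (sq_nonneg (x k ^ 2))]

end Rademacher

/-! ### Dimension-free covariance inequality for random vectors. -/

section HilbertCovariance

universe u

variable {Ω : Type*} {mΩ : MeasurableSpace Ω} {P : Measure Ω} [IsProbabilityMeasure P]

/-- `c` bounds the covariance of any two finite-dimensional random vectors of norm at most one
which are measurable with respect to `J` and `K`, uniformly in the dimension. -/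
def VectorCovarianceBound (P : Measure Ω) (J K : MeasurableSpace Ω) (c : ℝ) : Prop :=
  ∀ (ι : Type u) [Fintype ι] (ξ η : ι → Ω → ℝ), (∀ k, Measurable[J] (ξ k)) →
    (∀ k, Measurable[K] (η k)) → (∀ᵐ ω ∂P, ∑ k, ξ k ω ^ 2 ≤ 1) → (∀ᵐ ω ∂P, ∑ k, η k ω ^ 2 ≤ 1) →
    |∑ k, cov[ξ k, η k; P]| ≤ c

lemma abs_le_of_sum_sq_le {ι : Type*} [Fintype ι] {x : ι → ℝ} {B : ℝ} (hB : 0 ≤ B)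
    (h : ∑ k, x k ^ 2 ≤ B ^ 2) (k : ι) : |x k| ≤ B :=
  abs_le_of_sq_le_sq
    ((Finset.single_le_sum (fun i _ => sq_nonneg (x i)) (Finset.mem_univ k)).trans h) hB

lemma memLp_of_sum_sq_le {ι : Type*} [Fintype ι] {ξ : ι → Ω → ℝ} {B : ℝ} (hB : 0 ≤ B)
    (hm : ∀ k, Measurable (ξ k)) (h : ∀ᵐ ω ∂P, ∑ k, ξ k ω ^ 2 ≤ B ^ 2) (k : ι) :
    MemLp (ξ k) 2 P :=
  (MemLp.of_bound (p := ⊤) (hm k).aestronglyMeasurable B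
    (h.mono fun _ hω => abs_le_of_sum_sq_le hB hω k)).mono_exponent le_top

lemma abs_covariance_le_half_add {U V : Ω → ℝ} (hU : MemLp U 2 P) (hV : MemLp V 2 P) :
    |cov[U, V; P]| ≤ (∫ ω, U ω ^ 2 ∂P + ∫ ω, V ω ^ 2 ∂P) / 2 := by
  have h1 := variance_nonneg (U + V) P
  have h2 := variance_nonneg (U - V) P
  rw [variance_add hU hV] at h1
  rw [variance_sub hU hV] at h2
  have h3 := variance_le_expectation_sq (μ := P) hU.1
  have h4 := variance_le_expectation_sq (μ := P) hV.1
  simp only [Pi.pow_apply] at h3 h4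
  rw [abs_le]
  constructor <;> linarith

lemma integral_sum_sq_le {ι : Type*} [Fintype ι] {ξ : ι → Ω → ℝ} {B : ℝ}
    (hξ : ∀ k, MemLp (ξ k) 2 P) (h : ∀ᵐ ω ∂P, ∑ k, ξ k ω ^ 2 ≤ B) :
    ∑ k, ∫ ω, ξ k ω ^ 2 ∂P ≤ B := by
  rw [← integral_finsetSum _ fun k _ => (hξ k).integrable_sq]
  calc ∫ ω, ∑ k, ξ k ω ^ 2 ∂P ≤ ∫ _, B ∂P :=
        integral_mono_ae (integrable_finsetSum _ fun k _ => (hξ k).integrable_sq)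
          (integrable_const _) h
    _ = B := by simp

variable {J K : MeasurableSpace Ω}

/-- The a priori bound, free of mixing, from which the iteration of `VectorCovarianceBound.halve`
starts. -/
lemma vectorCovarianceBound_one (hJ : J ≤ mΩ) (hK : K ≤ mΩ) :
    VectorCovarianceBound.{u} P J K 1 := by
  intro ι _ ξ η hξ hη h1 h2
  have mξ := memLp_of_sum_sq_le zero_le_one (fun k => (hξ k).mono hJ le_rfl) (by simpa using h1)
  have mη := memLp_of_sum_sq_le zero_le_one (fun k => (hη k).mono hK le_rfl) (by simpa using h2)
  calc |∑ k, cov[ξ k, η k; P]| ≤ ∑ k, |cov[ξ k, η k; P]| := Finset.abs_sum_le_sum_abs _ _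
    _ ≤ ∑ k, (∫ ω, ξ k ω ^ 2 ∂P + ∫ ω, η k ω ^ 2 ∂P) / 2 :=
        Finset.sum_le_sum fun k _ => abs_covariance_le_half_add (mξ k) (mη k)
    _ = (∑ k, ∫ ω, ξ k ω ^ 2 ∂P + ∑ k, ∫ ω, η k ω ^ 2 ∂P) / 2 := by
        rw [← Finset.sum_div, Finset.sum_add_distrib]
    _ ≤ 1 := by linarith [integral_sum_sq_le mξ h1, integral_sum_sq_le mη h2]

/-- Truncation of a real number to the interval `[-7, 7]`. -/
noncomputable def clip (x : ℝ) : ℝ := max (-7) (min 7 x)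

lemma abs_clip_le (x : ℝ) : |clip x| ≤ 7 := by
  rw [abs_le, clip]
  exact ⟨le_max_left _ _, max_le (by norm_num) (min_le_left _ _)⟩

lemma clip_sq_le (x : ℝ) : clip x ^ 2 ≤ x ^ 2 := by
  rw [sq_le_sq, clip]
  rcases le_total x (-7) with h | h
  · rw [min_eq_right (by linarith), max_eq_left h, abs_of_nonpos (by norm_num),
      abs_of_nonpos (by linarith)]
    linarith
  · rcases le_total x 7 with h' | h'
    · rw [min_eq_right h', max_eq_right h]
    · rw [min_eq_left h', max_eq_right (by norm_num), abs_of_nonneg (by norm_num),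
        abs_of_nonneg (by linarith)]
      exact h'

/-- Where truncation acts, `x² ≥ 49`, so the squared excess is at most `x² ≤ x⁴ / 49`. The level 7
is chosen so that the fourth-moment constant 3 gives `3 / 49 ≤ 1 / 16`. -/
lemma sub_clip_sq_le (x : ℝ) : (x - clip x) ^ 2 ≤ x ^ 4 / 49 := by
  rw [clip]
  rcases le_total x (-7) with h | h
  · rw [min_eq_right (by linarith), max_eq_left h]
    have h1 : 49 ≤ x ^ 2 := by nlinarith
    nlinarith [mul_nonneg (sub_nonneg.2 h1) (sq_nonneg x)]
  · rcases le_total x 7 with h' | h'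
    · rw [min_eq_right h', max_eq_right h]
      simp
      positivity
    · rw [min_eq_left h', max_eq_right (by norm_num)]
      have h1 : 49 ≤ x ^ 2 := by nlinarith
      nlinarith [mul_nonneg (sub_nonneg.2 h1) (sq_nonneg x)]

lemma measurable_clip : Measurable clip :=
  measurable_const.max (measurable_const.min measurable_id)

lemma sum_covariance_eq_sign_average {ι : Type*} [Fintype ι] [DecidableEq ι] {ξ η : ι → Ω → ℝ}
    (hξ : ∀ k, MemLp (ξ k) 2 P) (hη : ∀ k, MemLp (η k) 2 P) :
    ∑ τ : ι → Bool, cov[fun ω => ∑ k, boolSign (τ k) * ξ k ω,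
      fun ω => ∑ k, boolSign (τ k) * η k ω; P] =
      Fintype.card (ι → Bool) * ∑ k, cov[ξ k, η k; P] := by
  have mX : ∀ τ : ι → Bool, MemLp (fun ω => ∑ k, boolSign (τ k) * ξ k ω) 2 P := fun τ =>
    memLp_finsetSum _ fun k _ => (hξ k).const_mul _
  have mY : ∀ τ : ι → Bool, MemLp (fun ω => ∑ k, boolSign (τ k) * η k ω) 2 P := fun τ =>
    memLp_finsetSum _ fun k _ => (hη k).const_mul _
  have e : ∀ τ : ι → Bool, cov[fun ω => ∑ k, boolSign (τ k) * ξ k ω,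
      fun ω => ∑ k, boolSign (τ k) * η k ω; P] =
      ∫ ω, (∑ k, boolSign (τ k) * ξ k ω) * (∑ k, boolSign (τ k) * η k ω) ∂P -
      (∑ k, boolSign (τ k) * ∫ ω, ξ k ω ∂P) * (∑ k, boolSign (τ k) * ∫ ω, η k ω ∂P) := fun τ => by
    rw [covariance_eq_sub (mX τ) (mY τ), integral_finsetSum, integral_finsetSum]
    · simp_rw [integral_const_mul]
      rfl
    · exact fun k _ => ((hη k).integrable (by norm_num)).const_mul _
    · exact fun k _ => ((hξ k).integrable (by norm_num)).const_mul _
  have e' : ∀ k, cov[ξ k, η k; P] =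
      ∫ ω, ξ k ω * η k ω ∂P - (∫ ω, ξ k ω ∂P) * ∫ ω, η k ω ∂P := fun k =>
    covariance_eq_sub (hξ k) (hη k)
  have iXY : ∀ τ : ι → Bool, Integrable (fun ω => (∑ k, boolSign (τ k) * ξ k ω) *
      ∑ k, boolSign (τ k) * η k ω) P := fun τ => (mX τ).integrable_mul (mY τ)
  have ixy : ∀ k, Integrable (fun ω => ξ k ω * η k ω) P := fun k => (hξ k).integrable_mul (hη k)
  simp_rw [e, e', Finset.sum_sub_distrib]
  rw [sum_sign_mul_sum, ← integral_finsetSum _ fun τ _ => iXY τ]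
  simp_rw [sum_sign_mul_sum]
  rw [integral_const_mul, integral_finsetSum _ fun k _ => ixy k]
  ring

/-- The sum of covariances is the average over sign patterns `τ` of the covariances of the scalar
sums `X τ`, `Y τ`. Their truncations are handled by the scalar inequality, at cost `4 · 7 · 7 · α`.
The tails, indexed by `τ` and divided by `√N`, form a new random vector of norm at most `1/4`, to
which the assumed bound `c` applies again. Two tail terms contribute `c/4` each. The new index type
is `ι → Bool`, which is why the bound is quantified over all finite index types. -/
lemma VectorCovarianceBound.halve (hJ : J ≤ mΩ) (hK : K ≤ mΩ) {α c : ℝ}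
    (hα : ∀ A B, MeasurableSet[J] A → MeasurableSet[K] B →
      |P.real (A ∩ B) - P.real A * P.real B| ≤ α)
    (hc : VectorCovarianceBound.{u} P J K c) :
    VectorCovarianceBound.{u} P J K (196 * α + c / 2) := by
  classical
  intro ι _ ξ η hξ hη h1 h2
  have mξ := memLp_of_sum_sq_le zero_le_one (fun k => (hξ k).mono hJ le_rfl) (by simpa using h1)
  have mη := memLp_of_sum_sq_le zero_le_one (fun k => (hη k).mono hK le_rfl) (by simpa using h2)
  set N : ℝ := ((Fintype.card (ι → Bool) : ℕ) : ℝ) with hN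
  have hN0 : 0 < N := by rw [hN]; exact_mod_cast Fintype.card_pos
  have hsN : √N * √N = N := Real.mul_self_sqrt hN0.le
  have hsN0 : 0 < √N := Real.sqrt_pos.2 hN0
  set X : (ι → Bool) → Ω → ℝ := fun τ ω => ∑ k, boolSign (τ k) * ξ k ω with hX
  set Y : (ι → Bool) → Ω → ℝ := fun τ ω => ∑ k, boolSign (τ k) * η k ω with hY
  have measX : ∀ τ, Measurable[J] (X τ) := fun τ =>
    Finset.measurable_fun_sum _ fun k _ => (hξ k).const_mul _
  have measY : ∀ τ, Measurable[K] (Y τ) := fun τ =>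
    Finset.measurable_fun_sum _ fun k _ => (hη k).const_mul _
  have mX : ∀ τ, MemLp (X τ) 2 P := fun τ => memLp_finsetSum _ fun k _ => (mξ k).const_mul _
  have mY : ∀ τ, MemLp (Y τ) 2 P := fun τ => memLp_finsetSum _ fun k _ => (mη k).const_mul _
  have measX' : ∀ τ, Measurable[J] (fun ω => clip (X τ ω)) := fun τ =>
    measurable_clip.comp (measX τ)
  have measY' : ∀ τ, Measurable[K] (fun ω => clip (Y τ ω)) := fun τ =>
    measurable_clip.comp (measY τ)
  have mX' : ∀ τ, MemLp (fun ω => clip (X τ ω)) 2 P := fun τ =>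
    memLp_of_abs_le hJ (measX' τ) (fun _ => abs_clip_le _) 2
  have mY' : ∀ τ, MemLp (fun ω => clip (Y τ ω)) 2 P := fun τ =>
    memLp_of_abs_le hK (measY' τ) (fun _ => abs_clip_le _) 2
  have sqSum : ∀ x : ι → ℝ, ∑ k, x k ^ 2 ≤ 1 →
      ∑ τ : ι → Bool, (∑ k, boolSign (τ k) * x k) ^ 2 ≤ N := fun x hx => by
    have := sum_sign_mul_sum Finset.univ x x
    simp only [← sq] at this
    rw [this]
    nlinarith
  -- The inequality used is `16 · 3 ≤ 49`.
  have tailSum : ∀ x : ι → ℝ, ∑ k, x k ^ 2 ≤ 1 →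
      16 * ∑ τ : ι → Bool, (∑ k, boolSign (τ k) * x k - clip (∑ k, boolSign (τ k) * x k)) ^ 2
        ≤ N := fun x hx => by
    have h3 := sum_sign_pow_four_le Finset.univ x
    have h4 : ∑ τ : ι → Bool,
        (∑ k, boolSign (τ k) * x k - clip (∑ k, boolSign (τ k) * x k)) ^ 2 ≤
        (∑ τ : ι → Bool, (∑ k, boolSign (τ k) * x k) ^ 4) / 49 := by
      rw [Finset.sum_div]
      exact Finset.sum_le_sum fun τ _ => sub_clip_sq_le _
    have h5 : (∑ k, x k ^ 2) ^ 2 ≤ 1 :=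
      pow_le_one₀ (Finset.sum_nonneg fun k _ => sq_nonneg _) hx
    have h6 : N * (3 * (∑ k, x k ^ 2) ^ 2) ≤ N * 3 := by nlinarith
    linarith
  have scale : ∀ (x : (ι → Bool) → ℝ) (b : ℝ), ∑ τ, (b / √N * x τ) ^ 2 =
      b ^ 2 * (∑ τ, x τ ^ 2) / N := fun x b => by
    simp_rw [mul_pow, div_pow, Real.sq_sqrt hN0.le, ← Finset.mul_sum]
    ring
  -- The tail factor can be enlarged by 4 and still have norm at most one; undoing the normalisation
  -- leaves `N / 4`.
  have covScale : ∀ U V : (ι → Bool) → Ω → ℝ,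
      |∑ τ, cov[fun ω => 4 / √N * U τ ω, fun ω => 1 / √N * V τ ω; P]| ≤ c →
      |∑ τ, cov[U τ, V τ; P]| ≤ N * (c / 4) := fun U V h => by
    simp_rw [covariance_const_mul_left, covariance_const_mul_right] at h
    have e : ∀ τ, 4 / √N * (1 / √N * cov[U τ, V τ; P]) = 4 / N * cov[U τ, V τ; P] := fun τ => by
      rw [← mul_assoc, div_mul_div_comm, hsN]
      ring
    simp_rw [e, ← Finset.mul_sum, abs_mul] at h
    rw [abs_of_pos (by positivity : 0 < 4 / N), div_mul_eq_mul_div, div_le_iff₀ hN0] at h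
    linarith
  have covScale' : ∀ U V : (ι → Bool) → Ω → ℝ,
      |∑ τ, cov[fun ω => 1 / √N * U τ ω, fun ω => 4 / √N * V τ ω; P]| ≤ c →
      |∑ τ, cov[U τ, V τ; P]| ≤ N * (c / 4) := fun U V h => by
    simp_rw [covariance_const_mul_left, covariance_const_mul_right] at h
    have e : ∀ τ, 1 / √N * (4 / √N * cov[U τ, V τ; P]) = 4 / N * cov[U τ, V τ; P] := fun τ => by
      rw [← mul_assoc, div_mul_div_comm, hsN]
      ring
    simp_rw [e, ← Finset.mul_sum, abs_mul] at h
    rw [abs_of_pos (by positivity : 0 < 4 / N), div_mul_eq_mul_div, div_le_iff₀ hN0] at h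
    linarith
  have b1 : |∑ τ, cov[fun ω => clip (X τ ω), fun ω => clip (Y τ ω); P]| ≤ N * (196 * α) := by
    refine (Finset.abs_sum_le_sum_abs _ _).trans ?_
    calc _ ≤ ∑ _τ : ι → Bool, 4 * α * 7 * 7 := Finset.sum_le_sum fun τ _ =>
          abs_covariance_le_of_bounded hJ hK hα (measX' τ) (fun _ => abs_clip_le _) (measY' τ)
            (fun _ => abs_clip_le _)
      _ = _ := by
          rw [Finset.sum_const, Finset.card_univ, nsmul_eq_mul]
          ring
  have b2 : |∑ τ, cov[fun ω => X τ ω - clip (X τ ω), fun ω => clip (Y τ ω); P]| ≤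
      N * (c / 4) := by
    refine covScale _ _ (hc _ _ _ (fun τ => ((measX τ).sub (measX' τ)).const_mul _)
      (fun τ => (measY' τ).const_mul _) ?_ ?_)
    · filter_upwards [h1] with ω hω
      rw [scale, div_le_one hN0]
      have := tailSum (fun k => ξ k ω) hω
      norm_num
      exact this
    · filter_upwards [h2] with ω hω
      rw [scale, div_le_one hN0]
      have := sqSum (fun k => η k ω) hω
      have h3 := Finset.sum_le_sum fun τ (_ : τ ∈ Finset.univ) => clip_sq_le (Y τ ω)
      norm_num
      exact h3.trans this
  have b3 : |∑ τ, cov[X τ, fun ω => Y τ ω - clip (Y τ ω); P]| ≤ N * (c / 4) := by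
    refine covScale' _ _ (hc _ _ _ (fun τ => (measX τ).const_mul _)
      (fun τ => ((measY τ).sub (measY' τ)).const_mul _) ?_ ?_)
    · filter_upwards [h1] with ω hω
      rw [scale, div_le_one hN0]
      have := sqSum (fun k => ξ k ω) hω
      norm_num
      exact this
    · filter_upwards [h2] with ω hω
      rw [scale, div_le_one hN0]
      have := tailSum (fun k => η k ω) hω
      norm_num
      exact this
  have split : ∀ τ, cov[X τ, Y τ; P] = cov[fun ω => clip (X τ ω), fun ω => clip (Y τ ω); P] +
      cov[fun ω => X τ ω - clip (X τ ω), fun ω => clip (Y τ ω); P] +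
      cov[X τ, fun ω => Y τ ω - clip (Y τ ω); P] := fun τ => by
    rw [covariance_fun_sub_left (mX τ) (mX' τ) (mY' τ),
      covariance_fun_sub_right (mX τ) (mY τ) (mY' τ)]
    ring
  have key := sum_covariance_eq_sign_average mξ mη
  change ∑ τ, cov[X τ, Y τ; P] = N * _ at key
  simp_rw [split, Finset.sum_add_distrib] at key
  have h6 : N * |∑ k, cov[ξ k, η k; P]| ≤ N * (196 * α + c / 2) := by
    rw [← abs_of_pos hN0, ← abs_mul, abs_of_pos hN0, ← key]
    refine (abs_add_three _ _ _).trans ?_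
    linarith
  exact le_of_mul_le_mul_left h6 hN0

/-- Covariance inequality for bounded random vectors under strong mixing, with a constant that
does not depend on the dimension. -/
lemma vectorCovarianceBound_of_alpha (hJ : J ≤ mΩ) (hK : K ≤ mΩ) {α : ℝ}
    (hα : ∀ A B, MeasurableSet[J] A → MeasurableSet[K] B →
      |P.real (A ∩ B) - P.real A * P.real B| ≤ α) :
    VectorCovarianceBound.{u} P J K (392 * α) := by
  have hα0 : 0 ≤ α := (abs_nonneg _).trans (hα ∅ ∅ (@MeasurableSet.empty _ J)
    (@MeasurableSet.empty _ K))
  -- `392 * α` is the fixed point of `c ↦ 196 * α + c / 2`; starting at distance at most 1 above it,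
  -- each step halves the excess.
  have h : ∀ m : ℕ, VectorCovarianceBound.{u} P J K (392 * α + (1 / 2) ^ m) := fun m => by
    induction m with
    | zero =>
      intro ι _ ξ η h1 h2 h3 h4
      have := vectorCovarianceBound_one hJ hK ι ξ η h1 h2 h3 h4
      simp only [pow_zero]
      linarith
    | succ m ih =>
      have h1 := ih.halve hJ hK hα
      have e : 196 * α + (392 * α + (1 / 2) ^ m) / 2 = 392 * α + (1 / 2) ^ (m + 1) := by ring
      rwa [e] at h1
  intro ι _ ξ η h1 h2 h3 h4
  have hlim : Tendsto (fun m : ℕ => 392 * α + (1 / 2 : ℝ) ^ m) atTop (𝓝 (392 * α + 0)) :=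
    (tendsto_pow_atTop_nhds_zero_of_lt_one (by norm_num) (by norm_num)).const_add _
  rw [add_zero] at hlim
  exact ge_of_tendsto' hlim fun m => h m ι ξ η h1 h2 h3 h4

lemma abs_sum_covariance_le (hJ : J ≤ mΩ) (hK : K ≤ mΩ) {α : ℝ}
    (hα : ∀ A B, MeasurableSet[J] A → MeasurableSet[K] B →
      |P.real (A ∩ B) - P.real A * P.real B| ≤ α)
    {ι : Type u} [Fintype ι] {ξ η : ι → Ω → ℝ} (hξ : ∀ k, Measurable[J] (ξ k))
    (hη : ∀ k, Measurable[K] (η k)) {B : ℝ} (hB : 0 < B)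
    (h1 : ∀ᵐ ω ∂P, ∑ k, ξ k ω ^ 2 ≤ B ^ 2) (h2 : ∀ᵐ ω ∂P, ∑ k, η k ω ^ 2 ≤ B ^ 2) :
    |∑ k, cov[ξ k, η k; P]| ≤ 392 * α * B ^ 2 := by
  have hB2 : 0 < B ^ 2 := by positivity
  have scale : ∀ x : ι → ℝ, ∑ k, x k ^ 2 ≤ B ^ 2 → ∑ k, (1 / B * x k) ^ 2 ≤ 1 := fun x hx => by
    simp_rw [mul_pow, ← Finset.mul_sum]
    rw [div_pow, one_pow, one_div_mul_eq_div, div_le_one hB2]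
    exact hx
  have h := vectorCovarianceBound_of_alpha hJ hK hα ι (fun k ω => 1 / B * ξ k ω)
    (fun k ω => 1 / B * η k ω) (fun k => (hξ k).const_mul _) (fun k => (hη k).const_mul _)
    (h1.mono fun ω hω => scale _ hω) (h2.mono fun ω hω => scale _ hω)
  simp_rw [covariance_const_mul_left, covariance_const_mul_right, ← mul_assoc,
    ← Finset.mul_sum, abs_mul] at h
  rw [abs_of_pos (by positivity : 0 < 1 / B), one_div_mul_one_div, ← sq, one_div_mul_eq_div,
    div_le_iff₀ hB2] at h
  exact h

end HilbertCovariance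

/-! ### Elementary properties of the mixing coefficients. -/

section MixingCoefficients

variable {Ω Z : Type*} [mΩ : MeasurableSpace Ω] [MeasurableSpace Z] {P : Measure Ω}
  [IsProbabilityMeasure P]

/-- Supplies the upper bound without which the real suprema defining the coefficients could take
their default value. -/
lemma abs_measureReal_inter_sub_le_one (A B : Set Ω) :
    |P.real (A ∩ B) - P.real A * P.real B| ≤ 1 := by
  have h1 : P.real (A ∩ B) ≤ 1 := measureReal_le_one
  have h2 : P.real A ≤ 1 := measureReal_le_one
  have h3 : P.real B ≤ 1 := measureReal_le_one
  have h4 : 0 ≤ P.real (A ∩ B) := measureReal_nonneg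
  have h5 : 0 ≤ P.real A := measureReal_nonneg
  have h6 : 0 ≤ P.real B := measureReal_nonneg
  rw [abs_le]
  constructor <;> nlinarith

lemma alphaCoeff_nonneg (J K : MeasurableSpace Ω) : 0 ≤ @alphaCoeff Ω mΩ P J K :=
  Real.iSup_nonneg fun _ => Real.iSup_nonneg fun _ => abs_nonneg _

lemma alphaCoeff_le_one (J K : MeasurableSpace Ω) : @alphaCoeff Ω mΩ P J K ≤ 1 :=
  Real.iSup_le (fun _ => Real.iSup_le (fun _ => 
    abs_measureReal_inter_sub_le_one (mΩ := mΩ) _ _) zero_le_one)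
    zero_le_one

lemma le_alphaCoeff {J K : MeasurableSpace Ω} {A B : Set Ω} (hA : MeasurableSet[J] A)
    (hB : MeasurableSet[K] B) :
    |P.real (A ∩ B) - P.real A * P.real B| ≤ @alphaCoeff Ω mΩ P J K := by
  have h1 : |P.real (A ∩ B) - P.real A * P.real B| ≤
      ⨆ B' : {B : Set Ω // MeasurableSet[K] B}, |P.real (A ∩ B'.1) - P.real A * P.real B'.1| :=
    le_ciSup (f := fun B' : {B : Set Ω // MeasurableSet[K] B} =>
      |P.real (A ∩ B'.1) - P.real A * P.real B'.1|)
      ⟨1, by rintro _ ⟨B', rfl⟩; exact abs_measureReal_inter_sub_le_one (mΩ := mΩ) _ _⟩ ⟨B, hB⟩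
  refine h1.trans ?_
  exact le_ciSup (f := fun A' : {A : Set Ω // MeasurableSet[J] A} =>
    ⨆ B' : {B : Set Ω // MeasurableSet[K] B}, |P.real (A'.1 ∩ B'.1) - P.real A'.1 * P.real B'.1|)
      ⟨1, by
        rintro _ ⟨A', rfl⟩
        exact Real.iSup_le (fun _ => abs_measureReal_inter_sub_le_one (mΩ := mΩ) _ _)
          zero_le_one⟩ ⟨A, hA⟩

lemma alphaMixing_nonneg (z : ℕ → Ω → Z) (j : ℕ) : 0 ≤ alphaMixing P z j :=
  Real.iSup_nonneg fun _ => alphaCoeff_nonneg _ _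

lemma alphaMixing_le_one (z : ℕ → Ω → Z) (j : ℕ) : alphaMixing P z j ≤ 1 :=
  Real.iSup_le (fun _ => alphaCoeff_le_one _ _) zero_le_one

lemma alphaCoeff_le_alphaMixing (z : ℕ → Ω → Z) (k j : ℕ) :
    alphaCoeff P (sigmaField z (Set.Iic k)) (sigmaField z (Set.Ici (k + j))) ≤
      alphaMixing P z j :=
  le_ciSup (f := fun k => alphaCoeff P (sigmaField z (Set.Iic k)) (sigmaField z (Set.Ici (k + j))))
    ⟨1, by rintro _ ⟨k, rfl⟩; exact alphaCoeff_le_one _ _⟩ k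

lemma sigmaField_le {z : ℕ → Ω → Z} (hz : ∀ t, Measurable (z t)) (I : Set ℕ) :
    sigmaField z I ≤ mΩ :=
  iSup₂_le fun i _ => (hz i).comap_le

lemma measurable_sigmaField (z : ℕ → Ω → Z) {I : Set ℕ} {i : ℕ} (hi : i ∈ I) :
    Measurable[sigmaField z I] (z i) :=
  Measurable.of_comap_le (le_iSup₂ (f := fun i (_ : i ∈ I) =>
    MeasurableSpace.comap (z i) inferInstance) i hi)

end MixingCoefficients

/-! ### Second moment of empirical means along a mixing sequence. -/

section EmpiricalMean

universe u

variable {Ω Z : Type*} [MeasurableSpace Ω] [MeasurableSpace Z] {P : Measure Ω}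
  [IsProbabilityMeasure P] {ρ : Measure Z} {z : ℕ → Ω → Z}

lemma sum_covariance_le_alphaMixing (hz : ∀ t, Measurable (z t)) (hρ : ∀ t, P.map (z t) = ρ)
    {ι : Type u} [Fintype ι] {φ : ι → Z → ℝ} (hφ : ∀ k, Measurable (φ k)) {B : ℝ} (hB : 0 < B)
    (hφB : ∀ᵐ p ∂ρ, ∑ k, φ k p ^ 2 ≤ B ^ 2) {i j : ℕ} (hij : i < j) :
    |∑ k, cov[fun ω => φ k (z i ω), fun ω => φ k (z j ω); P]| ≤
      392 * B ^ 2 * alphaMixing P z (j - i) := by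
  have hae : ∀ t, ∀ᵐ ω ∂P, ∑ k, φ k (z t ω) ^ 2 ≤ B ^ 2 := fun t =>
    ae_of_ae_map (hz t).aemeasurable (by rw [hρ t]; exact hφB)
  have h := abs_sum_covariance_le (P := P) (sigmaField_le hz (Set.Iic i))
    (sigmaField_le hz (Set.Ici (i + (j - i)))) (fun A B hA hB => le_alphaCoeff hA hB)
    (ξ := fun k ω => φ k (z i ω)) (η := fun k ω => φ k (z j ω))
    (fun k => (hφ k).comp (measurable_sigmaField z (Set.mem_Iic.2 le_rfl)))
    (fun k => (hφ k).comp (measurable_sigmaField z (Set.mem_Ici.2 (by omega)))) hB (hae i) (hae j)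
  have h2 := alphaCoeff_le_alphaMixing (P := P) z i (j - i)
  have h3 : 0 ≤ B ^ 2 := sq_nonneg B
  nlinarith

/-- For fixed `i`, each lag occurs at most once on either side of the diagonal, whence the factor 2
and a total linear in `n`. -/
lemma sum_sum_le_of_alpha {c : ℕ → ℕ → ℝ} {α : ℕ → ℝ} (hα : ∀ l, 0 ≤ α l) {V D : ℝ} (hD : 0 ≤ D)
    (hdiag : ∀ i, c i i ≤ V) (hlt : ∀ i j, i < j → c i j ≤ D * α (j - i))
    (hgt : ∀ i j, j < i → c i j ≤ D * α (i - j)) (n : ℕ) :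
    ∑ i ∈ Finset.range n, ∑ j ∈ Finset.range n, c i j ≤
      n * (V + 2 * D * ∑ l ∈ Finset.Icc 1 n, α l) := by
  have key : ∀ i ∈ Finset.range n, ∑ j ∈ Finset.range n, c i j ≤
      V + 2 * D * ∑ l ∈ Finset.Icc 1 n, α l := fun i hi => by
    rw [Finset.mem_range] at hi
    have h1 : ∑ j ∈ Finset.range n, c i j ≤ ∑ j ∈ Finset.range n, ((if j = i then V else 0) +
        (if j < i then D * α (i - j) else 0) + (if i < j then D * α (j - i) else 0)) := by
      refine Finset.sum_le_sum fun j _ => ?_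
      rcases lt_trichotomy i j with h | h | h
      · simpa [h, h.ne', h.not_gt] using hlt i j h
      · subst h; simpa using hdiag i
      · simpa [h, h.ne, h.not_gt] using hgt i j h
    have hsum : ∀ (s : Finset ℕ) (g : ℕ → ℕ), Set.InjOn g s →
        (∀ j ∈ s, g j ∈ Finset.Icc 1 n) →
        ∑ j ∈ s, D * α (g j) ≤ D * ∑ l ∈ Finset.Icc 1 n, α l := fun s g hg hs => by
      rw [← Finset.mul_sum, ← Finset.sum_image (f := α) hg]
      exact mul_le_mul_of_nonneg_left (Finset.sum_le_sum_of_subset_of_nonneg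
        (Finset.image_subset_iff.2 hs) fun _ _ _ => hα _) hD
    rw [Finset.sum_add_distrib, Finset.sum_add_distrib, ← Finset.sum_filter, ← Finset.sum_filter,
      ← Finset.sum_filter] at h1
    have h2 := hsum ((Finset.range n).filter (· < i)) (fun j => i - j)
      (fun a ha b hb hab => by simp at ha hb hab; omega)
      (fun j hj => by simp at hj ⊢; omega)
    have h3 := hsum ((Finset.range n).filter (i < ·)) (fun j => j - i)
      (fun a ha b hb hab => by simp at ha hb hab; omega)
      (fun j hj => by simp at hj ⊢; omega)
    have h4 : ∑ _j ∈ (Finset.range n).filter (· = i), V = V := by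
      rw [Finset.filter_eq']
      simp [hi]
    linarith
  calc _ ≤ ∑ _i ∈ Finset.range n, (V + 2 * D * ∑ l ∈ Finset.Icc 1 n, α l) :=
        Finset.sum_le_sum key
    _ = _ := by
      simp only [Finset.sum_const, Finset.card_range, nsmul_eq_mul]

lemma integral_sum_sq_empirical_le (hz : ∀ t, Measurable (z t)) (hρ : ∀ t, P.map (z t) = ρ)
    {ι : Type u} [Fintype ι] {φ : ι → Z → ℝ} (hφ : ∀ k, Measurable (φ k)) {B : ℝ} (hB : 0 < B)
    (hφB : ∀ᵐ p ∂ρ, ∑ k, φ k p ^ 2 ≤ B ^ 2) {n : ℕ} (hn : 1 ≤ n) :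
    ∑ k, ∫ ω, ((1 / (n : ℝ)) * ∑ i : Fin n, φ k (z i ω) - ∫ p, φ k p ∂ρ) ^ 2 ∂P ≤
      (1 / (n : ℝ)) * (∑ k, ∫ p, φ k p ^ 2 ∂ρ +
        784 * B ^ 2 * ∑ l ∈ Finset.Icc 1 n, alphaMixing P z l) := by
  have hn0 : (0 : ℝ) < n := by exact_mod_cast hn
  have hae : ∀ t, ∀ᵐ ω ∂P, ∑ k, φ k (z t ω) ^ 2 ≤ B ^ 2 := fun t =>
    ae_of_ae_map (hz t).aemeasurable (by rw [hρ t]; exact hφB)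
  have hL : ∀ k t, MemLp (fun ω => φ k (z t ω)) 2 P := fun k t =>
    memLp_of_sum_sq_le hB.le (ξ := fun k ω => φ k (z t ω)) (fun k => (hφ k).comp (hz t)) (hae t) k
  have hint : ∀ (g : Z → ℝ), Measurable g → ∀ t, ∫ ω, g (z t ω) ∂P = ∫ p, g p ∂ρ := fun g hg t => by
    rw [← hρ t, integral_map (hz t).aemeasurable hg.aestronglyMeasurable]
  have hmean : ∀ k, ∫ ω, (1 / (n : ℝ)) * ∑ i : Fin n, φ k (z i ω) ∂P = ∫ p, φ k p ∂ρ := fun k => by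
    rw [integral_const_mul,
      integral_finsetSum _ fun (i : Fin n) _ => (hL k i).integrable (by norm_num)]
    simp_rw [hint _ (hφ k)]
    simp only [Finset.sum_const, Finset.card_univ, Fintype.card_fin, nsmul_eq_mul]
    field_simp
  have hvar : ∀ k, ∫ ω, ((1 / (n : ℝ)) * ∑ i : Fin n, φ k (z i ω) - ∫ p, φ k p ∂ρ) ^ 2 ∂P =
      (1 / (n : ℝ)) ^ 2 * ∑ i ∈ Finset.range n, ∑ j ∈ Finset.range n,
        cov[fun ω => φ k (z i ω), fun ω => φ k (z j ω); P] := fun k => by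
    have h1 : ∫ ω, ((1 / (n : ℝ)) * ∑ i : Fin n, φ k (z i ω) - ∫ p, φ k p ∂ρ) ^ 2 ∂P =
        cov[fun ω => (1 / (n : ℝ)) * ∑ i : Fin n, φ k (z i ω),
          fun ω => (1 / (n : ℝ)) * ∑ i : Fin n, φ k (z i ω); P] := by
      rw [covariance, hmean k]
      simp_rw [sq]
    rw [h1, covariance_const_mul_left, covariance_const_mul_right,
      covariance_fun_sum_fun_sum (fun i : Fin n => hL k i) (fun i : Fin n => hL k i)]
    simp_rw [Finset.sum_range]
    ring
  simp_rw [hvar, ← Finset.mul_sum]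
  rw [Finset.sum_comm]
  have hcomm : ∀ i, ∑ k, ∑ j ∈ Finset.range n, cov[fun ω => φ k (z i ω), fun ω => φ k (z j ω); P] =
      ∑ j ∈ Finset.range n, ∑ k, cov[fun ω => φ k (z i ω), fun ω => φ k (z j ω); P] := fun i =>
    Finset.sum_comm
  simp_rw [hcomm]
  have hmain := sum_sum_le_of_alpha
    (c := fun i j => ∑ k, cov[fun ω => φ k (z i ω), fun ω => φ k (z j ω); P])
    (alphaMixing_nonneg (P := P) z) (V := ∑ k, ∫ p, φ k p ^ 2 ∂ρ) (D := 392 * B ^ 2)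
    (by positivity)
    (fun i => by
      refine Finset.sum_le_sum fun k _ => ?_
      have hm : AEMeasurable (fun ω => φ k (z i ω)) P := ((hφ k).comp (hz i)).aemeasurable
      rw [covariance_self hm]
      refine (variance_le_expectation_sq (hL k i).1).trans (le_of_eq ?_)
      exact hint (fun p => φ k p ^ 2) ((hφ k).pow_const 2) i)
    (fun i j hij => (le_abs_self _).trans (sum_covariance_le_alphaMixing hz hρ hφ hB hφB hij))
    (fun i j hij => by
      simp_rw [covariance_comm (fun ω => φ _ (z i ω))]
      exact (le_abs_self _).trans (sum_covariance_le_alphaMixing hz hρ hφ hB hφB hij)) n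
  calc _ ≤ (1 / (n : ℝ)) ^ 2 * (n * (∑ k, ∫ p, φ k p ^ 2 ∂ρ + 2 * (392 * B ^ 2) *
        ∑ l ∈ Finset.Icc 1 n, alphaMixing P z l)) :=
        mul_le_mul_of_nonneg_left hmain (by positivity)
    _ = _ := by field_simp; ring

/-- Variance bound for the empirical mean of a bounded square-summable family of functions along
a strong mixing sequence. -/
lemma lintegral_tsum_sq_empirical_le (hz : ∀ t, Measurable (z t)) (hρ : ∀ t, P.map (z t) = ρ)
    {ι : Type u} [Countable ι] {φ : ι → Z → ℝ} (hφ : ∀ k, Measurable (φ k)) {B V : ℝ} (hB : 0 < B)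
    (hφB : ∀ᵐ p ∂ρ, ∀ F : Finset ι, ∑ k ∈ F, φ k p ^ 2 ≤ B ^ 2)
    (hV : ∀ F : Finset ι, ∑ k ∈ F, ∫ p, φ k p ^ 2 ∂ρ ≤ V) {n : ℕ} (hn : 1 ≤ n) :
    ∫⁻ ω, ∑' k, ENNReal.ofReal
        (((1 / (n : ℝ)) * ∑ i : Fin n, φ k (z i ω) - ∫ p, φ k p ∂ρ) ^ 2) ∂P ≤
      ENNReal.ofReal ((1 / (n : ℝ)) * (V +
        784 * B ^ 2 * ∑ l ∈ Finset.Icc 1 n, alphaMixing P z l)) := by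
  have hmeas : ∀ k, Measurable (fun ω =>
      ((1 / (n : ℝ)) * ∑ i : Fin n, φ k (z i ω) - ∫ p, φ k p ∂ρ) ^ 2) := fun k => by
    have h1 : Measurable (fun ω => ∑ i : Fin n, φ k (z i ω)) :=
      Finset.measurable_fun_sum _ fun i _ => (hφ k).comp (hz i)
    exact ((h1.const_mul _).sub_const _).pow_const 2
  -- The countable sum is the supremum over finite subfamilies, and the bound for these does not see
  -- their size.
  rw [lintegral_tsum fun k => (hmeas k).ennreal_ofReal.aemeasurable, ENNReal.tsum_eq_iSup_sum]
  refine iSup_le fun F => ?_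
  have hFB : ∀ᵐ p ∂ρ, ∑ k : F, φ k p ^ 2 ≤ B ^ 2 := hφB.mono fun p hp => by
    rw [Finset.sum_coe_sort F fun k => φ k p ^ 2]
    exact hp F
  have hmain := integral_sum_sq_empirical_le hz hρ (φ := fun k : F => φ k) (fun k => hφ k) hB hFB hn
  have hL : ∀ k ∈ F, Integrable (fun ω =>
      ((1 / (n : ℝ)) * ∑ i : Fin n, φ k (z i ω) - ∫ p, φ k p ∂ρ) ^ 2) P := fun k hk => by
    have hae : ∀ t, ∀ᵐ ω ∂P, ∑ k : F, φ k (z t ω) ^ 2 ≤ B ^ 2 := fun t =>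
      ae_of_ae_map (hz t).aemeasurable (by rw [hρ t]; exact hFB)
    have h : ∀ t, MemLp (fun ω => φ k (z t ω)) 2 P := fun t =>
      memLp_of_sum_sq_le hB.le (ξ := fun (k : F) ω => φ k (z t ω)) (fun k => (hφ k).comp (hz t))
        (hae t) ⟨k, hk⟩
    exact (((memLp_finsetSum _ fun (i : Fin n) _ => h i).const_mul _).sub
      (memLp_const _)).integrable_sq
  rw [Finset.sum_coe_sort F fun k => ∫ ω, ((1 / (n : ℝ)) * ∑ i : Fin n, φ k (z i ω) -
    ∫ p, φ k p ∂ρ) ^ 2 ∂P, Finset.sum_coe_sort F fun k => ∫ p, φ k p ^ 2 ∂ρ] at hmain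
  calc ∑ k ∈ F, ∫⁻ ω, ENNReal.ofReal
        (((1 / (n : ℝ)) * ∑ i : Fin n, φ k (z i ω) - ∫ p, φ k p ∂ρ) ^ 2) ∂P
      = ∑ k ∈ F, ENNReal.ofReal (∫ ω, ((1 / (n : ℝ)) * ∑ i : Fin n, φ k (z i ω) -
          ∫ p, φ k p ∂ρ) ^ 2 ∂P) := Finset.sum_congr rfl fun k hk =>
        (ofReal_integral_eq_lintegral_ofReal (hL k hk)
          (Eventually.of_forall fun _ => sq_nonneg _)).symm
    _ = ENNReal.ofReal (∑ k ∈ F, ∫ ω, ((1 / (n : ℝ)) * ∑ i : Fin n, φ k (z i ω) -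
          ∫ p, φ k p ∂ρ) ^ 2 ∂P) :=
        (ENNReal.ofReal_sum_of_nonneg fun k _ => integral_nonneg fun _ => sq_nonneg _).symm
    _ ≤ _ := by
        refine ENNReal.ofReal_le_ofReal (hmain.trans ?_)
        exact mul_le_mul_of_nonneg_left (by linarith [hV F]) (by positivity)

end EmpiricalMean

open ContinuousLinearMap
open scoped RealInnerProductSpace

noncomputable section

/-! ### Resolvent estimates for `I I†`. -/

section Resolvent

variable {E H : Type*} [NormedAddCommGroup E] [InnerProductSpace ℝ E] [CompleteSpace E]
  [NormedAddCommGroup H] [InnerProductSpace ℝ H] [CompleteSpace H]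

/-- The resolvent `(lam + I I†)⁻¹` of the positive operator `I I†`. -/
def regInv (I : H →L[ℝ] E) (lam : ℝ) : E →L[ℝ] E :=
  Ring.inverse (lam • (1 : E →L[ℝ] E) + I ∘L adjoint I)

variable (I : H →L[ℝ] E) {lam : ℝ}

lemma inner_comp_adjoint_left (v w : E) : ⟪I (adjoint I v), w⟫ = ⟪adjoint I v, adjoint I w⟫ := by
  rw [adjoint_inner_right]

lemma isUnit_reg (hlam : 0 < lam) : IsUnit (lam • (1 : E →L[ℝ] E) + I ∘L adjoint I) := by
  refine isUnit_of_forall_le_norm_inner_map _ (c := ⟨lam, hlam.le⟩) hlam fun v => ?_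
  have h : ⟪(lam • (1 : E →L[ℝ] E) + I ∘L adjoint I) v, v⟫ = lam * ‖v‖ ^ 2 + ‖adjoint I v‖ ^ 2 := by
    simp only [add_apply, smul_apply, comp_apply, inner_add_left, inner_smul_left,
      real_inner_self_eq_norm_sq, inner_comp_adjoint_left]
    simp
  rw [h, Real.norm_of_nonneg (by positivity)]
  change ‖v‖ ^ 2 * lam ≤ _
  nlinarith [sq_nonneg ‖adjoint I v‖]

lemma smul_regInv_add (hlam : 0 < lam) (v : E) :
    lam • regInv I lam v + I (adjoint I (regInv I lam v)) = v := by
  have h := congrArg (fun A : E →L[ℝ] E => A v) (Ring.mul_inverse_cancel _ (isUnit_reg I hlam))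
  simpa [regInv] using h

lemma regInv_smul_add (hlam : 0 < lam) (v : E) :
    regInv I lam (lam • v + I (adjoint I v)) = v := by
  have h := congrArg (fun A : E →L[ℝ] E => A v) (Ring.inverse_mul_cancel _ (isUnit_reg I hlam))
  exact h

lemma regInv_comm (hlam : 0 < lam) (v : E) :
    regInv I lam (I (adjoint I v)) = I (adjoint I (regInv I lam v)) := by
  have h1 := smul_regInv_add I hlam v
  have h2 := regInv_smul_add I hlam v
  rw [map_add, map_smul] at h2
  exact add_left_cancel (h2.trans h1.symm)

lemma inner_regInv_left (hlam : 0 < lam) (v w : E) :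
    ⟪regInv I lam v, w⟫ = ⟪v, regInv I lam w⟫ := by
  conv_lhs => rw [← smul_regInv_add I hlam w]
  conv_rhs => rw [← smul_regInv_add I hlam v]
  simp only [inner_add_left, inner_add_right, inner_smul_left, inner_smul_right,
    inner_comp_adjoint_left, ← adjoint_inner_left I]
  simp

/-- Pairing the resolvent equation with `w = R I v` gives `lam ‖w‖² + ‖I† w‖² = ⟪v, I† w⟫`;
completing the square in `‖I† w‖` eliminates it. -/
lemma norm_regInv_apply_sq_le (hlam : 0 < lam) (v : H) :
    ‖regInv I lam (I v)‖ ^ 2 ≤ ‖v‖ ^ 2 / lam := by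
  set w := regInv I lam (I v) with hw
  have h1 := congrArg (fun u => ⟪u, w⟫) (smul_regInv_add I hlam (I v))
  simp only [← hw, inner_add_left, inner_smul_left, inner_comp_adjoint_left,
    real_inner_self_eq_norm_sq] at h1
  rw [← adjoint_inner_right I v w] at h1
  have h2 := real_inner_le_norm v (adjoint I w)
  rw [le_div_iff₀ hlam]
  simp at h1
  nlinarith [sq_nonneg (‖v‖ - 2 * ‖adjoint I w‖), sq_nonneg ‖v‖]

/-- In operator form, with `L = I I†`, this is `(L R)² ≤ L R`. Summed over an orthonormal basis, the
right side becomes the effective dimension. -/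
lemma norm_comp_adjoint_regInv_sq_le (hlam : 0 < lam) (b : E) :
    ‖I (adjoint I (regInv I lam b))‖ ^ 2 ≤ ⟪b, regInv I lam (I (adjoint I b))⟫ := by
  rw [regInv_comm I hlam]
  set w := regInv I lam b with hw
  have h1 := smul_regInv_add I hlam b
  rw [← hw] at h1
  have h2 : ⟪b, I (adjoint I w)⟫ = lam * ‖adjoint I w‖ ^ 2 + ‖I (adjoint I w)‖ ^ 2 := by
    conv_lhs => rw [← h1]
    rw [inner_add_left, inner_smul_left, real_inner_self_eq_norm_sq, ← adjoint_inner_left,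
      real_inner_self_eq_norm_sq]
    rfl
  rw [h2]
  nlinarith [sq_nonneg ‖adjoint I w‖]

/-- Second resolvent identity, applied to the solution of a perturbed regularized equation. -/
lemma apply_eq_regInv_of_eq (hlam : 0 < lam) {g d t : H} (h : t + lam • g = d) :
    I g = regInv I lam (I d) + regInv I lam (I (adjoint I (I g) - t)) := by
  rw [← map_add, ← map_add, ← h]
  conv_lhs => rw [← regInv_smul_add I hlam (I g)]
  congr 1
  simp only [map_add, map_sub, map_smul]
  abel

end Resolvent

/-! ### Spectral estimates from the source condition. -/

section SourceCondition

variable {E H : Type*} [NormedAddCommGroup E] [InnerProductSpace ℝ E] [CompleteSpace E]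
  [NormedAddCommGroup H] [InnerProductSpace ℝ H] [CompleteSpace H] (I : H →L[ℝ] E)

/-- The component of `h` in the eigenspace of `I I†` for `t`. -/
def eigenPart (t : ℝ) (h : E) : E :=
  (I ∘L adjoint I - t • ContinuousLinearMap.id ℝ E).ker.starProjection h

lemma apply_eigenPart (t : ℝ) (h : E) :
    I (adjoint I (eigenPart I t h)) = t • eigenPart I t h := by
  have h1 : eigenPart I t h ∈ (I ∘L adjoint I - t • ContinuousLinearMap.id ℝ E).ker :=
    Submodule.starProjection_apply_mem _ _
  rw [LinearMap.mem_ker] at h1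
  exact sub_eq_zero.1 h1

lemma inner_eigenPart_self (t : ℝ) (h : E) : ⟪eigenPart I t h, h⟫ = ‖eigenPart I t h‖ ^ 2 := by
  have key : ∀ (U : Submodule ℝ E) [U.HasOrthogonalProjection],
      ⟪U.starProjection h, h⟫ = ‖U.starProjection h‖ ^ 2 := fun U _ => by
    rw [← real_inner_self_eq_norm_sq, ← Submodule.inner_starProjection_left_eq_right,
      Submodule.starProjection_eq_self_iff.2 (Submodule.starProjection_apply_mem _ _)]
  exact key _

lemma inner_eigenPart_of_ne {s t : ℝ} (hst : s ≠ t) (h : E) :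
    ⟪eigenPart I s h, eigenPart I t h⟫ = 0 := by
  have h1 : s * ⟪eigenPart I s h, eigenPart I t h⟫ = t * ⟪eigenPart I s h, eigenPart I t h⟫ := by
    have e1 := inner_comp_adjoint_left I (eigenPart I s h) (eigenPart I t h)
    have e2 := inner_comp_adjoint_left I (eigenPart I t h) (eigenPart I s h)
    rw [apply_eigenPart, real_inner_smul_left] at e1 e2
    rw [e1, real_inner_comm (eigenPart I t h), e2, real_inner_comm]
  by_contra h0
  exact hst (mul_right_cancel₀ h0 h1)

lemma eigenvalue_nonneg {t : ℝ} {h : E} (h0 : eigenPart I t h ≠ 0) : 0 ≤ t := by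
  have h1 := inner_comp_adjoint_left I (eigenPart I t h) (eigenPart I t h)
  rw [apply_eigenPart, inner_smul_left, real_inner_self_eq_norm_sq,
    real_inner_self_eq_norm_sq] at h1
  have h2 : 0 < ‖eigenPart I t h‖ ^ 2 := by positivity
  by_contra! ht
  have h3 : t * ‖eigenPart I t h‖ ^ 2 < 0 := mul_neg_of_neg_of_pos ht h2
  have h4 := sq_nonneg ‖adjoint I (eigenPart I t h)‖
  simp at h1
  linarith

lemma eigenvalue_le {t : ℝ} {h : E} (h0 : eigenPart I t h ≠ 0) : t ≤ ‖I ∘L adjoint I‖ := by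
  have h1 := (I ∘L adjoint I).le_opNorm (eigenPart I t h)
  rw [comp_apply, apply_eigenPart, norm_smul] at h1
  exact (le_abs_self t).trans (le_of_mul_le_mul_right h1 (norm_pos_iff.2 h0))

lemma inner_sum_eigenPart (F : Finset ℝ) (a b : ℝ → ℝ) (h : E) :
    ⟪∑ t ∈ F, a t • eigenPart I t h, ∑ t ∈ F, b t • eigenPart I t h⟫ =
      ∑ t ∈ F, a t * b t * ‖eigenPart I t h‖ ^ 2 := by
  rw [sum_inner]
  refine Finset.sum_congr rfl fun s hs => ?_
  rw [inner_sum, Finset.sum_eq_single s]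
  · rw [inner_smul_left, inner_smul_right, real_inner_self_eq_norm_sq]
    simp
    ring
  · intro t _ ht
    rw [inner_smul_left, inner_smul_right, inner_eigenPart_of_ne I ht.symm]
    simp
  · exact fun h => absurd hs h

lemma sum_norm_eigenPart_sq_le (F : Finset ℝ) (h : E) :
    ∑ t ∈ F, ‖eigenPart I t h‖ ^ 2 ≤ ‖h‖ ^ 2 := by
  have h1 := inner_sum_eigenPart I F (fun _ => 1) (fun _ => 1) h
  simp only [one_smul, one_mul] at h1
  rw [real_inner_self_eq_norm_sq] at h1
  have h2 : ⟪∑ t ∈ F, eigenPart I t h, h⟫ = ∑ t ∈ F, ‖eigenPart I t h‖ ^ 2 := by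
    rw [sum_inner]
    exact Finset.sum_congr rfl fun t _ => inner_eigenPart_self I t h
  have h3 := real_inner_le_norm (∑ t ∈ F, eigenPart I t h) h
  rw [h2, ← h1] at h3
  rw [← h1]
  nlinarith [sq_nonneg (‖∑ t ∈ F, eigenPart I t h‖ - ‖h‖)]

/-- Bessel's inequality with weights. The weights need control only at actual eigenvalues, which lie
in `[0, ‖I I†‖]`. -/
lemma sum_mul_norm_eigenPart_sq_le (F : Finset ℝ) (c : ℝ → ℝ) {m : ℝ} (h : E) (hm : 0 ≤ m)
    (hc : ∀ t ∈ F, eigenPart I t h ≠ 0 → c t ≤ m) :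
    ∑ t ∈ F, c t * ‖eigenPart I t h‖ ^ 2 ≤ m * ‖h‖ ^ 2 := by
  calc _ ≤ ∑ t ∈ F, m * ‖eigenPart I t h‖ ^ 2 := by
        refine Finset.sum_le_sum fun t ht => ?_
        by_cases h0 : eigenPart I t h = 0
        · simp [h0]
        · exact mul_le_mul_of_nonneg_right (hc t ht h0) (sq_nonneg _)
    _ ≤ _ := by
        rw [← Finset.mul_sum]
        exact mul_le_mul_of_nonneg_left (sum_norm_eigenPart_sq_le I F h) hm

lemma regInv_eigenPart {lam : ℝ} (hlam : 0 < lam) (t : ℝ) (h : E) :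
    regInv I lam (eigenPart I t h) = (t + lam)⁻¹ • eigenPart I t h := by
  by_cases h0 : eigenPart I t h = 0
  · simp [h0]
  have ht := eigenvalue_nonneg I h0
  have h1 := regInv_smul_add I hlam (eigenPart I t h)
  rw [apply_eigenPart, ← add_smul, map_smul] at h1
  rw [← h1, smul_smul, add_comm t lam, inv_mul_cancel₀ (by positivity), one_smul, h1]

lemma regInv_sum_eigenPart {lam : ℝ} (hlam : 0 < lam) (F : Finset ℝ) (c : ℝ → ℝ) (h : E) :
    regInv I lam (∑ t ∈ F, c t • eigenPart I t h) =
      ∑ t ∈ F, (c t * (t + lam)⁻¹) • eigenPart I t h := by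
  rw [map_sum]
  refine Finset.sum_congr rfl fun t _ => ?_
  rw [map_smul, regInv_eigenPart I hlam, smul_smul]

/-- Weighted AM–GM: `t ^ r * lam ^ (1 - r) ≤ r t + (1 - r) lam ≤ t + lam`. -/
lemma rpow_mul_inv_add_le {t lam r : ℝ} (ht : 0 ≤ t) (hlam : 0 < lam) (hr0 : 0 ≤ r) (hr : r ≤ 1) :
    lam * (t ^ r * (t + lam)⁻¹) ≤ lam ^ r := by
  have h1 := Real.geom_mean_le_arith_mean2_weighted hr0 (sub_nonneg.2 hr) ht hlam.le (by ring)
  have h2 : t ^ r * lam ^ (1 - r) ≤ t + lam := by nlinarith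
  have h3 : lam = lam ^ r * lam ^ (1 - r) := by
    rw [← Real.rpow_add hlam]; simp
  have h4 : 0 < t + lam := by linarith
  have h5 : 0 < lam ^ r := Real.rpow_pos_of_pos hlam r
  rw [← mul_assoc, ← div_eq_mul_inv, div_le_iff₀ h4]
  calc lam * t ^ r = lam ^ r * (t ^ r * lam ^ (1 - r)) := by
        conv_lhs => rw [h3]
        rw [mul_assoc, mul_comm (lam ^ (1 - r))]
    _ ≤ _ := mul_le_mul_of_nonneg_left h2 h5.le

/-- The bias estimate: on an eigenspace the operator acts as the scalar `lam t ^ r / (t + lam) ≤ lam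
^ r`, and finite partial sums pass to the limit. -/
lemma norm_smul_regInv_tsum_le {lam r : ℝ} (hlam : 0 < lam) (hr0 : 0 ≤ r) (hr : r ≤ 1) (h : E) :
    ‖lam • regInv I lam (∑' t : ℝ, t ^ r • eigenPart I t h)‖ ≤ lam ^ r * ‖h‖ := by
  have hlr : 0 < lam ^ r := Real.rpow_pos_of_pos hlam r
  by_cases hs : Summable fun t : ℝ => t ^ r • eigenPart I t h
  · have hc : Continuous fun v : E => ‖lam • regInv I lam v‖ := by fun_prop
    refine le_of_tendsto ((hc.tendsto _).comp hs.hasSum) (Eventually.of_forall fun F => ?_)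
    simp only [Function.comp_apply]
    refine abs_le_of_sq_le_sq' ?_ (by positivity) |>.2
    rw [regInv_sum_eigenPart I hlam, Finset.smul_sum]
    simp_rw [smul_smul]
    rw [← real_inner_self_eq_norm_sq, inner_sum_eigenPart, mul_pow]
    refine sum_mul_norm_eigenPart_sq_le I F _ h (by positivity) fun t _ h0 => ?_
    have ht := eigenvalue_nonneg I h0
    have h1 := rpow_mul_inv_add_le ht hlam hr0 hr
    have h2 : 0 ≤ lam * (t ^ r * (t + lam)⁻¹) := by positivity
    nlinarith
  -- If the family were not summable, `tsum` would be zero by convention and the bound trivial;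
  -- summability thus need not be proved.
  · rw [tsum_eq_zero_of_not_summable hs]
    simp
    positivity

/-- The expression is `t ^ (2r - 1) * t² / (t + lam)²`. For `r ≥ 1/2` the first power stays bounded
near zero, so the bound is uniform in `lam`. -/
lemma rpow_mul_inv_add_sq_mul_le {t lam r c : ℝ} (ht : 0 ≤ t) (htc : t ≤ c) (hlam : 0 < lam)
    (hr0 : 1 / 2 ≤ r) (hr : r ≤ 1) :
    (t ^ r * (t + lam)⁻¹) * (t * (t ^ r * (t + lam)⁻¹)) ≤ 1 + c := by
  rcases ht.eq_or_lt with rfl | ht0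
  · simp; linarith
  have h1 : t ^ r * t ^ r ≤ (1 + c) * t := by
    have e : t ^ r * t ^ r = t ^ (2 * r - 1) * t := by
      rw [← Real.rpow_add ht0]
      nth_rewrite 3 [← Real.rpow_one t]
      rw [← Real.rpow_add ht0]
      ring_nf
    rw [e]
    refine mul_le_mul_of_nonneg_right ?_ ht
    rcases le_total t 1 with h | h
    · exact (Real.rpow_le_one ht h (by linarith)).trans (by linarith)
    · calc t ^ (2 * r - 1) ≤ t ^ (1 : ℝ) := Real.rpow_le_rpow_of_exponent_le h (by linarith)
        _ ≤ 1 + c := by rw [Real.rpow_one]; linarith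
  have h4 : 0 < t + lam := by linarith
  have e : (t ^ r * (t + lam)⁻¹) * (t * (t ^ r * (t + lam)⁻¹)) =
      (t ^ r * t ^ r) * t / (t + lam) ^ 2 := by
    field_simp
  rw [e, div_le_iff₀ (by positivity)]
  have h5 : t * t ≤ (t + lam) ^ 2 := by nlinarith
  calc t ^ r * t ^ r * t ≤ (1 + c) * t * t := mul_le_mul_of_nonneg_right h1 ht
    _ = (1 + c) * (t * t) := by ring
    _ ≤ _ := mul_le_mul_of_nonneg_left h5 (by linarith)

/-- Bounds the `H`-norm of the population solution independently of `lam`, hence also its supremum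
norm. -/
lemma norm_adjoint_regInv_tsum_le {lam r : ℝ} (hlam : 0 < lam) (hr0 : 1 / 2 ≤ r) (hr : r ≤ 1)
    (h : E) :
    ‖adjoint I (regInv I lam (∑' t : ℝ, t ^ r • eigenPart I t h))‖ ≤
      (1 + ‖I ∘L adjoint I‖) * ‖h‖ := by
  have hL : 0 ≤ ‖I ∘L adjoint I‖ := norm_nonneg _
  by_cases hs : Summable fun t : ℝ => t ^ r • eigenPart I t h
  · have hc : Continuous fun v : E => ‖adjoint I (regInv I lam v)‖ := by fun_prop
    refine le_of_tendsto ((hc.tendsto _).comp hs.hasSum) (Eventually.of_forall fun F => ?_)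
    simp only [Function.comp_apply]
    refine abs_le_of_sq_le_sq' ?_ (by positivity) |>.2
    rw [regInv_sum_eigenPart I hlam, ← real_inner_self_eq_norm_sq, adjoint_inner_right]
    have e : I (adjoint I (∑ t ∈ F, (t ^ r * (t + lam)⁻¹) • eigenPart I t h)) =
        ∑ t ∈ F, (t * (t ^ r * (t + lam)⁻¹)) • eigenPart I t h := by
      rw [map_sum, map_sum]
      refine Finset.sum_congr rfl fun t _ => ?_
      rw [map_smul, map_smul, apply_eigenPart, smul_smul, mul_comm]
    rw [real_inner_comm, e, inner_sum_eigenPart, mul_pow]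
    have h1 := sum_mul_norm_eigenPart_sq_le I F
      (fun t => (t ^ r * (t + lam)⁻¹) * (t * (t ^ r * (t + lam)⁻¹))) h
      (by positivity : 0 ≤ 1 + ‖I ∘L adjoint I‖) fun t _ h0 =>
        rpow_mul_inv_add_sq_mul_le (eigenvalue_nonneg I h0) (eigenvalue_le I h0) hlam hr0 hr
    refine h1.trans (mul_le_mul_of_nonneg_right ?_ (sq_nonneg _))
    nlinarith
  · rw [tsum_eq_zero_of_not_summable hs]
    simp
    positivity

end SourceCondition

/-! ### The RKHS, its inclusion into `L²`, and countability of bases. -/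

section Inclusion

variable {X : Type*} {H : Type*} [NormedAddCommGroup H] [InnerProductSpace ℝ H] [CompleteSpace H]
  [RKHS ℝ H X ℝ]

variable (H) in
/-- The representer `K_x` of the evaluation at `x`. -/
def representer (x : X) : H := RKHS.kerFun H x 1

lemma inner_representer (x : X) (f : H) : ⟪representer H x, f⟫ = f x := by
  simp [representer, RKHS.kerFun_inner]

lemma inner_representer_right (x : X) (f : H) : ⟪f, representer H x⟫ = f x := by
  rw [real_inner_comm, inner_representer]

variable [MetricSpace X] [CompactSpace X] {K : C(X × X, ℝ)}

lemma inner_representer_representer (hH : ∀ x y : X, RKHS.kernel H x y 1 = K (x, y)) (x y : X) :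
    ⟪representer H x, representer H y⟫ = K (x, y) := by
  rw [inner_representer, representer, RKHS.kerFun_apply, hH]

lemma norm_representer_sq (hH : ∀ x y : X, RKHS.kernel H x y 1 = K (x, y)) (x : X) :
    ‖representer H x‖ ^ 2 = K (x, x) := by
  rw [← real_inner_self_eq_norm_sq, inner_representer_representer hH]

/-- The squared distance of two representers is `K (y, y) - 2 K (y, x) + K (x, x)`, which is
continuous and vanishes at `y = x`. -/
lemma continuous_representer (hH : ∀ x y : X, RKHS.kernel H x y 1 = K (x, y)) :
    Continuous (representer H : X → H) := by
  rw [continuous_iff_continuousAt]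
  intro x
  have h1 : ∀ y, ‖representer H y - representer H x‖ ^ 2 = K (y, y) - 2 * K (y, x) + K (x, x) :=
    fun y => by
      rw [norm_sub_sq_real, norm_representer_sq hH, norm_representer_sq hH,
        inner_representer_representer hH]
  have h2 : ∀ y, ‖representer H y - representer H x‖ = √(K (y, y) - 2 * K (y, x) + K (x, x)) :=
    fun y => by rw [← h1, Real.sqrt_sq (norm_nonneg _)]
  rw [ContinuousAt, tendsto_iff_norm_sub_tendsto_zero]
  simp_rw [h2]
  have hc : Continuous fun y => √(K (y, y) - 2 * K (y, x) + K (x, x)) := by fun_prop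
  have h3 := hc.tendsto x
  have h4 : K (x, x) - 2 * K (x, x) + K (x, x) = 0 := by ring
  rwa [h4, Real.sqrt_zero] at h3

lemma exists_norm_representer_le (hH : ∀ x y : X, RKHS.kernel H x y 1 = K (x, y)) :
    ∃ κ, 0 < κ ∧ ∀ x : X, ‖representer H x‖ ≤ κ := by
  obtain ⟨C, hC⟩ := (isCompact_range (continuous_representer hH)).isBounded.exists_norm_le
  exact ⟨|C| + 1, by positivity, fun x => (hC _ ⟨x, rfl⟩).trans
    ((le_abs_self C).trans (by linarith))⟩

lemma continuous_of_kernel (hH : ∀ x y : X, RKHS.kernel H x y 1 = K (x, y)) (f : H) :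
    Continuous f := by
  have : (f : X → ℝ) = fun x => ⟪representer H x, f⟫ := funext fun x => (inner_representer x f).symm
  rw [this]
  exact (continuous_representer hH).inner continuous_const

lemma abs_apply_le {κ : ℝ} (hκ : ∀ x : X, ‖representer H x‖ ≤ κ) (f : H) (x : X) :
    |f x| ≤ κ * ‖f‖ := by
  rw [← inner_representer x f]
  exact (abs_real_inner_le_norm _ _).trans (mul_le_mul_of_nonneg_right (hκ x) (norm_nonneg _))

/-- The inclusion of `H` into the continuous functions. -/
def toContinuous (hH : ∀ x y : X, RKHS.kernel H x y 1 = K (x, y)) : H →L[ℝ] C(X, ℝ) :=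
  LinearMap.mkContinuousOfExistsBound
    { toFun := fun f => ⟨f, continuous_of_kernel hH f⟩
      map_add' := fun f g => by ext x; simp
      map_smul' := fun c f => by ext x; simp }
    (by
      obtain ⟨κ, hκ0, hκ⟩ := exists_norm_representer_le hH
      refine ⟨κ, fun f => ?_⟩
      rw [ContinuousMap.norm_le _ (by positivity)]
      exact fun x => abs_apply_le hκ f x)

variable [MeasurableSpace X] [BorelSpace X]

/-- The inclusion of `H` into `L²(μ)`. -/
def inclusion (hH : ∀ x y : X, RKHS.kernel H x y 1 = K (x, y)) (μ : Measure X)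
    [IsFiniteMeasure μ] : H →L[ℝ] Lp ℝ 2 μ :=
  ContinuousMap.toLp 2 μ ℝ ∘L toContinuous hH

variable (hH : ∀ x y : X, RKHS.kernel H x y 1 = K (x, y)) (μ : Measure X) [IsFiniteMeasure μ]

lemma coeFn_inclusion (f : H) : inclusion hH μ f =ᵐ[μ] f :=
  ContinuousMap.coeFn_toLp μ (toContinuous hH f)

lemma inclusion_representer (hK : IsMercerKernel K) (x : X) :
    inclusion hH μ (representer H x) = kernelLp K μ x := by
  rw [inclusion, kernelLp, comp_apply]
  congr 1
  ext y
  change representer H x y = K (x, y)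
  rw [hK.symm, ← hH, representer, RKHS.kerFun_apply]

lemma adjoint_inclusion_apply (hK : IsMercerKernel K) (g : Lp ℝ 2 μ) (x : X) :
    adjoint (inclusion hH μ) g x = ⟪kernelLp K μ x, g⟫ := by
  rw [← inner_representer, adjoint_inner_right, inclusion_representer hH μ hK]

/-- Transfers the resolvent and spectral estimates for `I I†` to the integral operator. -/
lemma integralOp_eq (hK : IsMercerKernel K) :
    integralOp K μ = inclusion hH μ ∘L adjoint (inclusion hH μ) := by
  refine ContinuousLinearMap.ext fun g => ext_inner_left ℝ fun w => ?_
  have h1 : integralOp K μ g = ∫ x, g x • kernelLp K μ x ∂μ := rfl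
  rw [h1, ← integral_inner (integrable_smul_kernelLp K μ g), comp_apply, ← adjoint_inner_left,
    real_inner_comm, adjoint_inner_left, L2.inner_def]
  refine integral_congr_ae ?_
  filter_upwards [coeFn_inclusion hH μ (adjoint (inclusion hH μ) w)] with x hx
  rw [hx, adjoint_inclusion_apply hH μ hK, inner_smul_right, real_inner_comm]
  simp [mul_comm]

lemma inner_adjoint_inclusion (f : H) (g : Lp ℝ 2 μ) :
    ⟪f, adjoint (inclusion hH μ) g⟫ = ∫ x, f x * g x ∂μ := by
  rw [adjoint_inner_right, L2.inner_def]
  refine integral_congr_ae ?_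
  filter_upwards [coeFn_inclusion hH μ f] with x hx
  rw [hx]
  simp [mul_comm]

/-- Every vector has only countably many nonzero coefficients. A basis vector outside all the
supports of `D` would be orthogonal to `D`, hence zero. Countability permits the exchange of basis
sums with integrals over the sample. -/
lemma countable_of_separating {E : Type*} [NormedAddCommGroup E] [InnerProductSpace ℝ E]
    {ι : Type*} (b : HilbertBasis ι ℝ E) {D : Set E} (hD : D.Countable)
    (hsep : ∀ v : E, (∀ d ∈ D, ⟪v, d⟫ = 0) → v = 0) : Countable ι := by
  have h1 : ∀ d : E, (Function.support fun i => ⟪d, b i⟫ * ⟪b i, d⟫).Countable := fun d =>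
    (b.summable_inner_mul_inner d d).countable_support
  have h2 : (Set.univ : Set ι) ⊆ ⋃ d ∈ D, Function.support fun i => ⟪d, b i⟫ * ⟪b i, d⟫ := by
    intro i _
    by_contra h
    simp only [Set.mem_iUnion, Function.mem_support, not_exists, not_not] at h
    refine b.orthonormal.ne_zero i (hsep _ fun d hd => ?_)
    have h3 := h d hd
    rwa [real_inner_comm, mul_self_eq_zero] at h3
  exact Set.countable_univ_iff.1 ((hD.biUnion fun d _ => h1 d).mono h2)

lemma countable_basis_rkhs (hH : ∀ x y : X, RKHS.kernel H x y 1 = K (x, y))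
    {ι : Type*} (e : HilbertBasis ι ℝ H) : Countable ι := by
  obtain ⟨D, hDc, hD⟩ := TopologicalSpace.exists_countable_dense X
  refine countable_of_separating e (hDc.image (representer H)) fun f hf => RKHS.ext fun x => ?_
  have h1 : (f : X → ℝ) = fun _ => 0 :=
    (continuous_of_kernel hH f).ext_on hD continuous_const fun d hd => by
      have := hf _ ⟨d, hd, rfl⟩
      rwa [real_inner_comm, inner_representer] at this
  rw [h1]
  simp

lemma countable_basis_Lp {ι : Type*} (b : HilbertBasis ι ℝ (Lp ℝ 2 μ)) : Countable ι := by
  have : Fact ((2 : ℝ≥0∞) ≠ ∞) := ⟨by norm_num⟩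
  obtain ⟨D, hDc, hD⟩ := TopologicalSpace.exists_countable_dense (Lp ℝ 2 μ)
  exact countable_of_separating b hDc fun v hv => hD.eq_zero_of_inner_left ℝ hv

end Inclusion

/-! ### Parseval and Bessel in coordinates. -/

section Parseval

variable {E : Type*} [NormedAddCommGroup E] [InnerProductSpace ℝ E]

lemma ofReal_norm_sq_eq_tsum {ι : Type*} (b : HilbertBasis ι ℝ E) (v : E) :
    ENNReal.ofReal (‖v‖ ^ 2) = ∑' i, ENNReal.ofReal (⟪b i, v⟫ ^ 2) := by
  have h := b.hasSum_inner_mul_inner v v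
  have h1 : ∀ i, ⟪v, b i⟫ * ⟪b i, v⟫ = ⟪b i, v⟫ ^ 2 := fun i => by
    rw [real_inner_comm, sq]
  simp_rw [h1, real_inner_self_eq_norm_sq] at h
  rw [← h.tsum_eq, ENNReal.ofReal_tsum_of_nonneg (fun _ => sq_nonneg _) h.summable]

lemma sum_inner_sq_le {ι : Type*} (b : HilbertBasis ι ℝ E) (v : E) (F : Finset ι) :
    ∑ i ∈ F, ⟪b i, v⟫ ^ 2 ≤ ‖v‖ ^ 2 := by
  have h := b.orthonormal.sum_inner_products_le v (s := F)
  simpa using h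

end Parseval

/-! ### The empirical normal equation and continuity of the estimator. -/

section Empirical

variable {X : Type*} {H : Type*} [NormedAddCommGroup H] [InnerProductSpace ℝ H] [CompleteSpace H]
  [RKHS ℝ H X ℝ] {n : ℕ}

variable (H) in
/-- The empirical integral operator `n⁻¹ ∑ᵢ ⟪K_{xᵢ}, ·⟫ K_{xᵢ}`. -/
def empOp (D : Fin n → X × ℝ) : H →L[ℝ] H :=
  (1 / (n : ℝ)) • ∑ i, InnerProductSpace.rankOne ℝ (representer H (D i).1) (representer H (D i).1)

variable (H) in
/-- The empirical data vector `n⁻¹ ∑ᵢ yᵢ K_{xᵢ}`. -/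
def empVec (D : Fin n → X × ℝ) : H := (1 / (n : ℝ)) • ∑ i, (D i).2 • representer H (D i).1

lemma inner_empOp (D : Fin n → X × ℝ) (u f : H) :
    ⟪u, empOp H D f⟫ = (1 / (n : ℝ)) * ∑ i, f (D i).1 * u (D i).1 := by
  simp only [empOp, smul_apply, sum_apply, InnerProductSpace.rankOne_apply, inner_smul_right,
    inner_sum, inner_representer, inner_representer_right]

lemma inner_empVec (D : Fin n → X × ℝ) (u : H) :
    ⟪u, empVec H D⟫ = (1 / (n : ℝ)) * ∑ i, (D i).2 * u (D i).1 := by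
  simp only [empVec, inner_smul_right, inner_sum, inner_representer_right]

lemma inner_empOp_self_nonneg (D : Fin n → X × ℝ) (f : H) : 0 ≤ ⟪f, empOp H D f⟫ := by
  rw [inner_empOp]
  exact mul_nonneg (by positivity) (Finset.sum_nonneg fun i _ => mul_self_nonneg _)

lemma isUnit_empOp (D : Fin n → X × ℝ) {lam : ℝ} (hlam : 0 < lam) :
    IsUnit (lam • (1 : H →L[ℝ] H) + empOp H D) := by
  refine isUnit_of_forall_le_norm_inner_map _ (c := ⟨lam, hlam.le⟩) hlam fun v => ?_
  have h : ⟪(lam • (1 : H →L[ℝ] H) + empOp H D) v, v⟫ = lam * ‖v‖ ^ 2 + ⟪v, empOp H D v⟫ := by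
    rw [real_inner_comm, add_apply, smul_apply, inner_add_right, inner_smul_right,
      ← real_inner_self_eq_norm_sq]
    rfl
  have h2 := inner_empOp_self_nonneg D v
  rw [h, Real.norm_of_nonneg (by positivity)]
  change ‖v‖ ^ 2 * lam ≤ _
  linarith

/-- Exact second-order expansion of the quadratic risk: the quadratic part is nonnegative and the
linear part vanishes when `f` solves the normal equation. -/
lemma regRisk_add (D : Fin n → X × ℝ) (lam : ℝ) (f k : H) :
    regRisk D lam (f + k) = regRisk D lam f + lam * ‖k‖ ^ 2 + ⟪k, empOp H D k⟫ +
      2 * ⟪k, lam • f + empOp H D f - empVec H D⟫ := by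
  have h3 : ∑ i, ((f + k) (D i).1 - (D i).2) ^ 2 =
      ∑ i, (f (D i).1 - (D i).2) ^ 2 + ∑ i, k (D i).1 * k (D i).1 +
      2 * (∑ i, f (D i).1 * k (D i).1 - ∑ i, (D i).2 * k (D i).1) := by
    rw [← Finset.sum_sub_distrib, Finset.mul_sum, ← Finset.sum_add_distrib,
      ← Finset.sum_add_distrib]
    refine Finset.sum_congr rfl fun i _ => ?_
    rw [RKHS.coe_add, Pi.add_apply]
    ring
  rw [inner_sub_right, inner_add_right, inner_smul_right, inner_empOp, inner_empOp, inner_empVec,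
    regRisk, regRisk, h3, norm_add_sq_real, real_inner_comm]
  ring

lemma krr_eq (D : Fin n → X × ℝ) {lam : ℝ} (hlam : 0 < lam) :
    krr H D lam = Ring.inverse (lam • (1 : H →L[ℝ] H) + empOp H D) (empVec H D) := by
  set f := Ring.inverse (lam • (1 : H →L[ℝ] H) + empOp H D) (empVec H D) with hf
  have h1 : lam • f + empOp H D f = empVec H D :=
    congrArg (fun A : H →L[ℝ] H => A (empVec H D)) (Ring.mul_inverse_cancel _ (isUnit_empOp D hlam))
  refine (existsUnique_regRisk_minimizer (H := H) D hlam).unique (krr_spec D hlam) fun g => ?_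
  have h2 := regRisk_add D lam f (g - f)
  rw [h1, sub_self, inner_zero_right, add_sub_cancel] at h2
  rw [h2]
  have h3 := inner_empOp_self_nonneg D (g - f)
  have h4 : 0 ≤ lam * ‖g - f‖ ^ 2 := by positivity
  linarith

lemma empOp_krr_add (D : Fin n → X × ℝ) {lam : ℝ} (hlam : 0 < lam) :
    empOp H D (krr H D lam) + lam • krr H D lam = empVec H D := by
  rw [krr_eq D hlam, add_comm]
  exact congrArg (fun A : H →L[ℝ] H => A (empVec H D))
    (Ring.mul_inverse_cancel _ (isUnit_empOp D hlam))

variable [MetricSpace X] [CompactSpace X] {K : C(X × X, ℝ)}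

/-- Makes the error a measurable function of the sample. It rests on the closed form `krr_eq` and
continuity of inversion at units. -/
lemma continuous_krr (hH : ∀ x y : X, RKHS.kernel H x y 1 = K (x, y)) {lam : ℝ} (hlam : 0 < lam) :
    Continuous fun D : Fin n → X × ℝ => krr H D lam := by
  have hr := continuous_representer hH
  have hri : ∀ i, Continuous fun D : Fin n → X × ℝ => representer H (D i).1 := fun i =>
    hr.comp (continuous_fst.comp (continuous_apply i))
  have hemp : Continuous fun D : Fin n → X × ℝ => empOp H D := by
    refine Continuous.const_smul (g := fun D : Fin n → X × ℝ => ∑ i, InnerProductSpace.rankOne ℝ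
      (representer H (D i).1) (representer H (D i).1)) (continuous_finsetSum _ fun i _ => ?_)
      (1 / (n : ℝ))
    exact ((InnerProductSpace.rankOne ℝ).continuous.comp (hri i)).clm_apply (hri i)
  have hop : Continuous fun D : Fin n → X × ℝ => lam • (1 : H →L[ℝ] H) + empOp H D :=
    continuous_const.add hemp
  have hvec : Continuous fun D : Fin n → X × ℝ => empVec H D := by
    refine (continuous_finsetSum _ fun i _ => ?_).const_smul _
    exact (continuous_snd.comp (continuous_apply i)).smul (hri i)
  simp_rw [fun D : Fin n → X × ℝ => krr_eq (H := H) D hlam]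
  refine Continuous.clm_apply ?_ hvec
  rw [continuous_iff_continuousAt]
  intro D
  obtain ⟨u, hu⟩ := isUnit_empOp (H := H) D hlam
  have h := NormedRing.inverse_continuousAt u
  rw [hu] at h
  exact ContinuousAt.comp (f := fun D : Fin n → X × ℝ => lam • (1 : H →L[ℝ] H) + empOp H D) h
    hop.continuousAt

end Empirical

/-! ### Decomposition of the sampling error. -/

section Error

variable {X : Type*} [MetricSpace X] [CompactSpace X] [MeasurableSpace X] [BorelSpace X]
  {K : C(X × X, ℝ)} {H : Type*} [NormedAddCommGroup H] [InnerProductSpace ℝ H] [CompleteSpace H]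
  [RKHS ℝ H X ℝ] (hH : ∀ x y : X, RKHS.kernel H x y 1 = K (x, y))
  (ρ : Measure (X × ℝ)) [IsProbabilityMeasure ρ]

/-- The population regularized solution `(lam + I† I)⁻¹ I† f`. -/
def popReg (lam : ℝ) (f : Lp ℝ 2 ρ.fst) : H :=
  adjoint (inclusion hH ρ.fst) (regInv (inclusion hH ρ.fst) lam f)

lemma sub_inclusion_popReg {lam : ℝ} (hlam : 0 < lam) (f : Lp ℝ 2 ρ.fst) :
    f - inclusion hH ρ.fst (popReg hH ρ lam f) = lam • regInv (inclusion hH ρ.fst) lam f := by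
  rw [sub_eq_iff_eq_add]
  exact (smul_regInv_add (inclusion hH ρ.fst) hlam f).symm

lemma integrable_snd_mul (hH : ∀ x y : X, RKHS.kernel H x y 1 = K (x, y)) {M : ℝ}
    (hy : ∀ᵐ p ∂ρ, |p.2| ≤ M) (u : H) : Integrable (fun p : X × ℝ => p.2 * u p.1) ρ := by
  obtain ⟨κ, hκ0, hκ⟩ := exists_norm_representer_le hH
  refine Integrable.of_bound (C := M * (κ * ‖u‖)) ?_ ?_
  · exact (measurable_snd.mul
      ((continuous_of_kernel hH u).measurable.comp measurable_fst)).aestronglyMeasurable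
  · filter_upwards [hy] with p hp
    rw [Real.norm_eq_abs, abs_mul]
    exact mul_le_mul hp (abs_apply_le hκ u p.1) (abs_nonneg _) ((abs_nonneg _).trans hp)

lemma integral_snd_mul (hH : ∀ x y : X, RKHS.kernel H x y 1 = K (x, y)) {M : ℝ}
    (hy : ∀ᵐ p ∂ρ, |p.2| ≤ M) (u : H) :
    ∫ p, p.2 * u p.1 ∂ρ = ∫ x, u x * regressionFn ρ x ∂ρ.fst := by
  rw [← Measure.integral_condKernel (integrable_snd_mul ρ hH hy u)]
  refine integral_congr_ae (Eventually.of_forall fun x => ?_)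
  simp only [regressionFn]
  rw [integral_mul_const, mul_comm]

lemma integral_fst_eq (g : X → ℝ) (hg : Measurable g) :
    ∫ p : X × ℝ, g p.1 ∂ρ = ∫ x, g x ∂ρ.fst := by
  rw [Measure.fst, integral_map measurable_fst.aemeasurable hg.aestronglyMeasurable]

/-- The function `(x, y) ↦ (y - f(x)) u(x)`. -/
def residualMul (f u : H) (p : X × ℝ) : ℝ := (p.2 - f p.1) * u p.1

/-- The residual of the population solution in the empirical normal equation. -/
def residual {n : ℕ} (D : Fin n → X × ℝ) (lam : ℝ) (f : H) : H :=
  empVec H D - empOp H D f - lam • f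

lemma measurable_residualMul (hH : ∀ x y : X, RKHS.kernel H x y 1 = K (x, y)) (f u : H) :
    Measurable (residualMul f u : X × ℝ → ℝ) :=
  (measurable_snd.sub ((continuous_of_kernel hH f).measurable.comp measurable_fst)).mul
    ((continuous_of_kernel hH u).measurable.comp measurable_fst)

lemma integral_mul_eq_inner (u f : H) :
    ∫ x, u x * f x ∂ρ.fst = ⟪inclusion hH ρ.fst u, inclusion hH ρ.fst f⟫ := by
  rw [← adjoint_inner_right, inner_adjoint_inclusion]
  refine integral_congr_ae ?_
  filter_upwards [coeFn_inclusion hH ρ.fst f] with x hx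
  rw [hx]

lemma integrable_mul_fst (hH : ∀ x y : X, RKHS.kernel H x y 1 = K (x, y)) (u f : H) :
    Integrable (fun p : X × ℝ => f p.1 * u p.1) ρ := by
  obtain ⟨κ, hκ0, hκ⟩ := exists_norm_representer_le hH
  refine Integrable.of_bound (C := (κ * ‖f‖) * (κ * ‖u‖)) ?_ (Eventually.of_forall fun p => ?_)
  · exact (((continuous_of_kernel hH f).measurable.comp measurable_fst).mul
      ((continuous_of_kernel hH u).measurable.comp measurable_fst)).aestronglyMeasurable
  · rw [Real.norm_eq_abs, abs_mul]
    exact mul_le_mul (abs_apply_le hκ f p.1) (abs_apply_le hκ u p.1) (abs_nonneg _) (by positivity)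

/-- Disintegration replaces `y` by the regression function, and `f - I g = lam R f`. Hence the term
`lam • g` in `residual` is exactly the centring of the empirical mean. -/
lemma integral_residualMul {M : ℝ} (hy : ∀ᵐ p ∂ρ, |p.2| ≤ M) {lam : ℝ} (hlam : 0 < lam)
    {f : Lp ℝ 2 ρ.fst} (hf : regressionFn ρ =ᵐ[ρ.fst] f) (u : H) :
    ∫ p, residualMul (popReg hH ρ lam f) u p ∂ρ = lam * ⟪u, popReg hH ρ lam f⟫ := by
  set g := popReg hH ρ lam f with hg
  have h1 : ∫ p, residualMul g u p ∂ρ = ∫ p, p.2 * u p.1 ∂ρ - ∫ p, g p.1 * u p.1 ∂ρ := by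
    rw [← integral_sub (integrable_snd_mul ρ hH hy u) (integrable_mul_fst ρ hH u g)]
    simp only [residualMul, sub_mul]
  have h2 : ∫ p : X × ℝ, g p.1 * u p.1 ∂ρ = ⟪inclusion hH ρ.fst u, inclusion hH ρ.fst g⟫ := by
    rw [integral_fst_eq ρ (fun x => g x * u x) ((continuous_of_kernel hH g).measurable.mul
      (continuous_of_kernel hH u).measurable), ← integral_mul_eq_inner]
    simp_rw [mul_comm]
  have h3 : ∫ p, p.2 * u p.1 ∂ρ = ⟪inclusion hH ρ.fst u, f⟫ := by
    rw [integral_snd_mul ρ hH hy, ← adjoint_inner_right, inner_adjoint_inclusion]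
    refine integral_congr_ae ?_
    filter_upwards [hf] with x hx
    rw [hx]
  rw [h1, h2, h3, ← inner_sub_right, hg, sub_inclusion_popReg hH ρ hlam, ← adjoint_inner_right,
    map_smul, inner_smul_right]
  rfl

lemma inner_residual {M : ℝ} (hy : ∀ᵐ p ∂ρ, |p.2| ≤ M) {lam : ℝ} (hlam : 0 < lam)
    {f : Lp ℝ 2 ρ.fst} (hf : regressionFn ρ =ᵐ[ρ.fst] f) {n : ℕ} (D : Fin n → X × ℝ) (u : H) :
    ⟪u, residual D lam (popReg hH ρ lam f)⟫ =
      (1 / (n : ℝ)) * ∑ i, residualMul (popReg hH ρ lam f) u (D i) -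
        ∫ p, residualMul (popReg hH ρ lam f) u p ∂ρ := by
  rw [integral_residualMul hH ρ hy hlam hf, residual, inner_sub_right, inner_sub_right,
    inner_smul_right, inner_empOp, inner_empVec, ← mul_sub, ← Finset.sum_sub_distrib]
  simp only [residualMul, sub_mul]

/-- The deviation of the empirical from the population integral operator. -/
def opDev {n : ℕ} (D : Fin n → X × ℝ) (u : H) : H :=
  empOp H D u - adjoint (inclusion hH ρ.fst) (inclusion hH ρ.fst u)

lemma inner_opDev {n : ℕ} (D : Fin n → X × ℝ) (u f : H) :
    ⟪f, opDev hH ρ D u⟫ = (1 / (n : ℝ)) * ∑ i, u (D i).1 * f (D i).1 -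
      ∫ p : X × ℝ, u p.1 * f p.1 ∂ρ := by
  rw [opDev, inner_sub_right, inner_empOp, adjoint_inner_right, ← integral_mul_eq_inner,
    integral_fst_eq ρ (fun x => u x * f x) ((continuous_of_kernel hH u).measurable.mul
      (continuous_of_kernel hH f).measurable)]
  simp_rw [mul_comm (u _)]

lemma inner_opDev_comm {n : ℕ} (D : Fin n → X × ℝ) (u f : H) :
    ⟪f, opDev hH ρ D u⟫ = ⟪u, opDev hH ρ D f⟫ := by
  rw [inner_opDev, inner_opDev]
  simp_rw [mul_comm (u _)]

variable {n : ℕ} (D : Fin n → X × ℝ) {lam : ℝ} (f : H)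

/-- The empirical operator is positive, so pairing the normal equation with the difference leaves
`lam ‖·‖²` as a lower bound. -/
lemma norm_krr_sub_le (hlam : 0 < lam) :
    lam * ‖krr H D lam - f‖ ≤ ‖residual D lam f‖ := by
  set g := krr H D lam - f with hg
  have h1 : empOp H D g + lam • g = residual D lam f := by
    rw [residual, hg, map_sub, smul_sub, ← empOp_krr_add D hlam]
    abel
  have h2 : ⟪g, residual D lam f⟫ = ⟪g, empOp H D g⟫ + lam * ‖g‖ ^ 2 := by
    rw [← h1, inner_add_right, inner_smul_right, real_inner_self_eq_norm_sq]
  have h3 := real_inner_le_norm g (residual D lam f)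
  have h4 := inner_empOp_self_nonneg D g
  rcases (norm_nonneg g).eq_or_lt with h0 | h0
  · rw [← h0, mul_zero]; positivity
  · refine le_of_mul_le_mul_left ?_ h0
    nlinarith

lemma inclusion_krr_sub (hlam : 0 < lam) :
    inclusion hH ρ.fst (krr H D lam - f) =
      regInv (inclusion hH ρ.fst) lam (inclusion hH ρ.fst (residual D lam f)) -
      regInv (inclusion hH ρ.fst) lam (inclusion hH ρ.fst (opDev hH ρ D (krr H D lam - f))) := by
  have h1 : empOp H D (krr H D lam - f) + lam • (krr H D lam - f) = residual D lam f := by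
    rw [residual, map_sub, smul_sub, ← empOp_krr_add D hlam]
    abel
  have h2 : adjoint (inclusion hH ρ.fst) (inclusion hH ρ.fst (krr H D lam - f)) -
      empOp H D (krr H D lam - f) = -opDev hH ρ D (krr H D lam - f) := by
    rw [opDev, neg_sub]
  rw [apply_eq_regInv_of_eq (inclusion hH ρ.fst) hlam h1, h2, map_neg, map_neg, ← sub_eq_add_neg]

variable {ι κ : Type*} (b : HilbertBasis ι ℝ (Lp ℝ 2 ρ.fst)) (e : HilbertBasis κ ℝ H)

/-- The functions `I† (lam + I I†)⁻¹ b`, by which `(lam + I I†)⁻¹ I` is tested against `b`. -/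
def testFn (lam : ℝ) (v : Lp ℝ 2 ρ.fst) : H :=
  adjoint (inclusion hH ρ.fst) (regInv (inclusion hH ρ.fst) lam v)

lemma inner_testFn (hlam : 0 < lam) (v : Lp ℝ 2 ρ.fst) (g : H) :
    ⟪v, regInv (inclusion hH ρ.fst) lam (inclusion hH ρ.fst g)⟫ = ⟪testFn hH ρ lam v, g⟫ := by
  rw [testFn, adjoint_inner_left, inner_regInv_left _ hlam]

lemma ofReal_norm_regInv_sq (hlam : 0 < lam) (g : H) :
    ENNReal.ofReal (‖regInv (inclusion hH ρ.fst) lam (inclusion hH ρ.fst g)‖ ^ 2) =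
      ∑' k, ENNReal.ofReal (⟪testFn hH ρ lam (b k), g⟫ ^ 2) := by
  rw [ofReal_norm_sq_eq_tsum b]
  simp_rw [inner_testFn hH ρ hlam]

/-- Hilbert–Schmidt norm in place of operator norm. Here `g` will depend on the sample, so it must
be split off; self-adjointness moves the deviation onto the deterministic test functions, and
Cauchy–Schwarz then removes `g`. -/
lemma ofReal_norm_regInv_opDev_sq_le (hlam : 0 < lam) (g : H) :
    ENNReal.ofReal (‖regInv (inclusion hH ρ.fst) lam
        (inclusion hH ρ.fst (opDev hH ρ D g))‖ ^ 2) ≤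
      (∑' q : ι × κ, ENNReal.ofReal (⟪e q.2, opDev hH ρ D (testFn hH ρ lam (b q.1))⟫ ^ 2)) *
        ENNReal.ofReal (‖g‖ ^ 2) := by
  rw [ofReal_norm_regInv_sq hH ρ b hlam, ENNReal.tsum_prod
    (f := fun k j => ENNReal.ofReal (⟪e j, opDev hH ρ D (testFn hH ρ lam (b k))⟫ ^ 2)),
    ← ENNReal.tsum_mul_right]
  refine ENNReal.tsum_le_tsum fun k => ?_
  rw [← ofReal_norm_sq_eq_tsum e, ← ENNReal.ofReal_mul (sq_nonneg _)]
  refine ENNReal.ofReal_le_ofReal ?_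
  rw [inner_opDev_comm, ← mul_pow, sq_le_sq, abs_of_nonneg (by positivity : 0 ≤ _ * ‖g‖)]
  exact (abs_real_inner_le_norm _ _).trans (le_of_eq (mul_comm _ _))

end Error

/-! ### Squared deviations and Cauchy–Schwarz for their roots. -/

section SquaredDeviation

variable {Ω Z : Type*} [MeasurableSpace Ω] [MeasurableSpace Z]

/-- The squared norm of the deviation of the empirical mean of the family `φ` from its expectation,
along the first `n` terms of the sequence `z`. -/
def sqDev {ι : Type*} (ρ : Measure Z) (z : ℕ → Z) (n : ℕ) (φ : ι → Z → ℝ) : ℝ≥0∞ :=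
  ∑' k, ENNReal.ofReal (((1 / (n : ℝ)) * ∑ i : Fin n, φ k (z i) - ∫ p, φ k p ∂ρ) ^ 2)

lemma measurable_sqDev {ι : Type*} [Countable ι] (ρ : Measure Z) {z : ℕ → Ω → Z}
    (hz : ∀ t, Measurable (z t)) (n : ℕ) {φ : ι → Z → ℝ} (hφ : ∀ k, Measurable (φ k)) :
    Measurable fun ω => sqDev ρ (fun t => z t ω) n φ := by
  refine Measurable.tsum fun k => ?_
  have h1 : Measurable (fun ω => ∑ i : Fin n, φ k (z i ω)) :=
    Finset.measurable_fun_sum _ fun i _ => (hφ k).comp (hz i)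
  exact (((h1.const_mul _).sub_const _).pow_const 2).ennreal_ofReal

lemma lintegral_sqrt_mul_sqrt_le {P : Measure Ω} {p q : Ω → ℝ≥0∞} (hp : Measurable p)
    (hq : Measurable q) :
    ∫⁻ ω, p ω ^ (1 / 2 : ℝ) * q ω ^ (1 / 2 : ℝ) ∂P ≤
      (∫⁻ ω, p ω ∂P) ^ (1 / 2 : ℝ) * (∫⁻ ω, q ω ∂P) ^ (1 / 2 : ℝ) := by
  have h := ENNReal.lintegral_mul_le_Lp_mul_Lq P (p := 2) (q := 2)
    (by constructor <;> norm_num) (hp.pow_const (1 / 2 : ℝ)).aemeasurable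
    (hq.pow_const (1 / 2 : ℝ)).aemeasurable
  simp_rw [← ENNReal.rpow_mul] at h
  norm_num at h
  simpa using h

lemma lintegral_sqrt_le {P : Measure Ω} [IsProbabilityMeasure P] {p : Ω → ℝ≥0∞}
    (hp : Measurable p) :
    ∫⁻ ω, p ω ^ (1 / 2 : ℝ) ∂P ≤ (∫⁻ ω, p ω ∂P) ^ (1 / 2 : ℝ) := by
  have h := lintegral_sqrt_mul_sqrt_le (P := P) hp (measurable_const (a := (1 : ℝ≥0∞)))
  simpa using h

lemma ofReal_sq_rpow_half {x : ℝ} (hx : 0 ≤ x) :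
    ENNReal.ofReal (x ^ 2) ^ (1 / 2 : ℝ) = ENNReal.ofReal x := by
  rw [ENNReal.ofReal_rpow_of_nonneg (sq_nonneg x) (by norm_num), ← Real.sqrt_eq_rpow,
    Real.sqrt_sq hx]

end SquaredDeviation

/-! ### Expected size of the three squared deviations. -/

section ExpectedError

variable {X : Type*} [MetricSpace X] [CompactSpace X] [MeasurableSpace X] [BorelSpace X]
  {K : C(X × X, ℝ)} {H : Type*} [NormedAddCommGroup H] [InnerProductSpace ℝ H] [CompleteSpace H]
  [RKHS ℝ H X ℝ] (hH : ∀ x y : X, RKHS.kernel H x y 1 = K (x, y))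
  (ρ : Measure (X × ℝ)) [IsProbabilityMeasure ρ]

lemma measurable_rkhs (hH : ∀ x y : X, RKHS.kernel H x y 1 = K (x, y)) (u : H) :
    Measurable fun p : X × ℝ => u p.1 :=
  (continuous_of_kernel hH u).measurable.comp measurable_fst

section Pointwise

variable {ι κ : Type*} (b : HilbertBasis ι ℝ (Lp ℝ 2 ρ.fst)) (e : HilbertBasis κ ℝ H) {lam : ℝ}

/-- The values `testFn hH ρ lam (b k) x` are the coordinates of `R I K_x` in the basis `b`. -/
lemma sum_testFn_sq_le (hlam : 0 < lam) {B : ℝ} (hB : ∀ x : X, ‖representer H x‖ ≤ B)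
    (x : X) (F : Finset ι) :
    ∑ k ∈ F, testFn hH ρ lam (b k) x ^ 2 ≤ B ^ 2 / lam := by
  have h1 : ∀ k, testFn hH ρ lam (b k) x =
      ⟪b k, regInv (inclusion hH ρ.fst) lam (inclusion hH ρ.fst (representer H x))⟫ := fun k => by
    rw [inner_testFn hH ρ hlam, inner_representer_right]
  simp_rw [h1]
  refine (sum_inner_sq_le b _ F).trans ((norm_regInv_apply_sq_le _ hlam _).trans ?_)
  have := hB x
  gcongr

lemma sum_basis_sq_le {B : ℝ} (hB : ∀ x : X, ‖representer H x‖ ≤ B) (x : X) (F : Finset κ) :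
    ∑ j ∈ F, e j x ^ 2 ≤ B ^ 2 := by
  simp_rw [← fun j => inner_representer_right x (e j)]
  refine (sum_inner_sq_le e _ F).trans ?_
  have := hB x
  gcongr

lemma integral_rkhs_sq (u : H) :
    ∫ p : X × ℝ, u p.1 ^ 2 ∂ρ = ‖inclusion hH ρ.fst u‖ ^ 2 := by
  simp_rw [sq (u _)]
  rw [integral_fst_eq ρ (fun x => u x * u x) ((continuous_of_kernel hH u).measurable.mul
    (continuous_of_kernel hH u).measurable), integral_mul_eq_inner hH, real_inner_self_eq_norm_sq]

lemma integrable_rkhs_sq (hH : ∀ x y : X, RKHS.kernel H x y 1 = K (x, y)) (u : H) :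
    Integrable (fun p : X × ℝ => u p.1 ^ 2) ρ := by
  simp_rw [sq]
  exact integrable_mul_fst ρ hH u u

lemma residualMul_sq_le {c : ℝ} {f : H} {p : X × ℝ} (hc : |p.2 - f p.1| ≤ c) (u : H) :
    residualMul f u p ^ 2 ≤ c ^ 2 * u p.1 ^ 2 := by
  rw [residualMul, mul_pow]
  exact mul_le_mul_of_nonneg_right (sq_le_sq.2 (hc.trans (le_abs_self c))) (sq_nonneg _)

lemma integral_residualMul_sq_le {c : ℝ} {f : H} (hc : ∀ᵐ p ∂ρ, |p.2 - f p.1| ≤ c) (u : H) :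
    ∫ p, residualMul f u p ^ 2 ∂ρ ≤ c ^ 2 * ‖inclusion hH ρ.fst u‖ ^ 2 := by
  rw [← integral_rkhs_sq, ← integral_const_mul]
  refine integral_mono_of_nonneg (Eventually.of_forall fun _ => sq_nonneg _)
    ((integrable_rkhs_sq ρ hH u).const_mul _) ?_
  filter_upwards [hc] with p hp
  exact residualMul_sq_le hp u

lemma sum_norm_inclusion_testFn_sq_le (hlam : 0 < lam) (hK : IsMercerKernel K) {N : ℝ} (hN : 0 ≤ N)
    (hdim : ∑' k, ENNReal.ofReal ⟪b k, (Ring.inverse (lam • (1 : Lp ℝ 2 ρ.fst →L[ℝ] Lp ℝ 2 ρ.fst) +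
      integralOp K ρ.fst) * integralOp K ρ.fst) (b k)⟫ ≤ ENNReal.ofReal N) (F : Finset ι) :
    ∑ k ∈ F, ‖inclusion hH ρ.fst (testFn hH ρ lam (b k))‖ ^ 2 ≤ N := by
  rw [← ENNReal.ofReal_le_ofReal_iff hN, ENNReal.ofReal_sum_of_nonneg fun _ _ => sq_nonneg _]
  refine le_trans ?_ hdim
  refine le_trans (Finset.sum_le_sum fun k _ => ?_) (ENNReal.sum_le_tsum F)
  refine ENNReal.ofReal_le_ofReal ?_
  rw [integralOp_eq hH ρ.fst hK]
  exact norm_comp_adjoint_regInv_sq_le _ hlam (b k)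

/-- Deterministic error decomposition in terms of three squared deviations. -/
lemma ofReal_norm_inclusion_krr_sub_le (hlam : 0 < lam) {M : ℝ} (hy : ∀ᵐ p ∂ρ, |p.2| ≤ M)
    {f : Lp ℝ 2 ρ.fst} (hf : regressionFn ρ =ᵐ[ρ.fst] f) (z : ℕ → X × ℝ) (n : ℕ) :
    ENNReal.ofReal ‖inclusion hH ρ.fst (krr H (fun i : Fin n => z i) lam - popReg hH ρ lam f)‖ ≤
      sqDev ρ z n (fun k => residualMul (popReg hH ρ lam f) (testFn hH ρ lam (b k))) ^ (1 / 2 : ℝ) +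
      ENNReal.ofReal lam⁻¹ *
        (sqDev ρ z n (fun (q : ι × κ) (p : X × ℝ) =>
          testFn hH ρ lam (b q.1) p.1 * e q.2 p.1) ^ (1 / 2 : ℝ) *
        sqDev ρ z n (fun j => residualMul (popReg hH ρ lam f) (e j)) ^ (1 / 2 : ℝ)) := by
  set D : Fin n → X × ℝ := fun i => z i with hD
  set g := popReg hH ρ lam f with hg
  have hp : sqDev ρ z n (fun k => residualMul g (testFn hH ρ lam (b k))) =
      ENNReal.ofReal (‖regInv (inclusion hH ρ.fst) lam
        (inclusion hH ρ.fst (residual D lam g))‖ ^ 2) := by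
    rw [ofReal_norm_regInv_sq hH ρ b hlam]
    simp_rw [hg, inner_residual hH ρ hy hlam hf]
    rfl
  have hd : sqDev ρ z n (fun j => residualMul g (e j)) =
      ENNReal.ofReal (‖residual D lam g‖ ^ 2) := by
    rw [ofReal_norm_sq_eq_tsum e]
    simp_rw [hg, inner_residual hH ρ hy hlam hf]
    rfl
  have hq := ofReal_norm_regInv_opDev_sq_le hH ρ D b e hlam (krr H D lam - g)
  simp_rw [inner_opDev] at hq
  change _ ≤ sqDev ρ z n (fun (q : ι × κ) (p : X × ℝ) =>
          testFn hH ρ lam (b q.1) p.1 * e q.2 p.1) * _ at hq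
  have hq2 := ENNReal.rpow_le_rpow hq (by norm_num : (0 : ℝ) ≤ 1 / 2)
  rw [ENNReal.mul_rpow_of_nonneg _ _ (by norm_num), ofReal_sq_rpow_half (norm_nonneg _),
    ofReal_sq_rpow_half (norm_nonneg _)] at hq2
  have hgd : ENNReal.ofReal ‖krr H D lam - g‖ ≤
      ENNReal.ofReal lam⁻¹ * ENNReal.ofReal ‖residual D lam g‖ := by
    rw [← ENNReal.ofReal_mul (by positivity)]
    refine ENNReal.ofReal_le_ofReal ?_
    rw [inv_mul_eq_div, le_div_iff₀ hlam, mul_comm]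
    exact norm_krr_sub_le D g hlam
  rw [hp, hd, ofReal_sq_rpow_half (norm_nonneg _), ofReal_sq_rpow_half (norm_nonneg _),
    inclusion_krr_sub hH ρ D g hlam]
  refine (ENNReal.ofReal_le_ofReal (norm_sub_le _ _)).trans ?_
  rw [ENNReal.ofReal_add (norm_nonneg _) (norm_nonneg _)]
  refine add_le_add le_rfl (hq2.trans ?_)
  rw [mul_left_comm]
  exact mul_le_mul_right hgd _

end Pointwise

variable {Ω : Type*} [MeasurableSpace Ω] {P : Measure Ω} [IsProbabilityMeasure P]
  {z : ℕ → Ω → X × ℝ}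
  {ι κ : Type*} [Countable ι] [Countable κ] (b : HilbertBasis ι ℝ (Lp ℝ 2 ρ.fst))
  (e : HilbertBasis κ ℝ H) {lam : ℝ} {B c N : ℝ} {f : H}

/-- The diagonal terms use second moments and see `N`; the mixing covariances use only pointwise
bounds and therefore cost `B ^ 2 / lam`. -/
lemma lintegral_sqDev_residual_testFn_le (hz : ∀ t, Measurable (z t)) (hρ : ∀ t, P.map (z t) = ρ)
    (hlam : 0 < lam) (hB0 : 0 < B) (hB : ∀ x : X, ‖representer H x‖ ≤ B) (hc0 : 0 < c)
    (hc : ∀ᵐ p ∂ρ, |p.2 - f p.1| ≤ c)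
    (hN : ∀ F : Finset ι, ∑ k ∈ F, ‖inclusion hH ρ.fst (testFn hH ρ lam (b k))‖ ^ 2 ≤ N)
    {n : ℕ} (hn : 1 ≤ n) :
    ∫⁻ ω, sqDev ρ (fun t => z t ω) n (fun k => residualMul f (testFn hH ρ lam (b k))) ∂P ≤
      ENNReal.ofReal ((1 / (n : ℝ)) * (c ^ 2 * N +
        784 * (c ^ 2 * (B ^ 2 / lam)) * ∑ l ∈ Finset.Icc 1 n, alphaMixing P z l)) := by
  have e1 : c ^ 2 * (B ^ 2 / lam) = (c * B / √lam) ^ 2 := by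
    rw [div_pow, Real.sq_sqrt hlam.le]; ring
  rw [e1]
  refine lintegral_tsum_sq_empirical_le hz hρ (fun k => measurable_residualMul hH _ _)
    (by positivity) ?_ (fun F => ?_) hn
  · filter_upwards [hc] with p hp F
    rw [← e1]
    refine (Finset.sum_le_sum fun k _ => residualMul_sq_le hp _).trans ?_
    rw [← Finset.mul_sum]
    exact mul_le_mul_of_nonneg_left (sum_testFn_sq_le hH ρ b hlam hB p.1 F) (sq_nonneg c)
  · refine (Finset.sum_le_sum fun k _ => integral_residualMul_sq_le hH ρ hc _).trans ?_
    rw [← Finset.mul_sum]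
    exact mul_le_mul_of_nonneg_left (hN F) (sq_nonneg c)

lemma lintegral_sqDev_residual_basis_le (hH : ∀ x y : X, RKHS.kernel H x y 1 = K (x, y))
    (hz : ∀ t, Measurable (z t)) (hρ : ∀ t, P.map (z t) = ρ)
    (hB0 : 0 < B) (hB : ∀ x : X, ‖representer H x‖ ≤ B) (hc0 : 0 < c)
    (hc : ∀ᵐ p ∂ρ, |p.2 - f p.1| ≤ c) {n : ℕ} (hn : 1 ≤ n) :
    ∫⁻ ω, sqDev ρ (fun t => z t ω) n (fun j => residualMul f (e j)) ∂P ≤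
      ENNReal.ofReal ((1 / (n : ℝ)) * (c ^ 2 * B ^ 2 +
        784 * (c ^ 2 * B ^ 2) * ∑ l ∈ Finset.Icc 1 n, alphaMixing P z l)) := by
  have hint : ∀ u : H, Integrable (fun p : X × ℝ => c ^ 2 * u p.1 ^ 2) ρ := fun u =>
    (integrable_rkhs_sq ρ hH u).const_mul _
  rw [← mul_pow]
  refine lintegral_tsum_sq_empirical_le hz hρ (fun k => measurable_residualMul hH _ _)
    (by positivity) ?_ (fun F => ?_) hn
  · filter_upwards [hc] with p hp F
    refine (Finset.sum_le_sum fun k _ => residualMul_sq_le hp _).trans ?_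
    rw [← Finset.mul_sum, mul_pow]
    exact mul_le_mul_of_nonneg_left (sum_basis_sq_le e hB p.1 F) (sq_nonneg c)
  · calc ∑ j ∈ F, ∫ p, residualMul f (e j) p ^ 2 ∂ρ
        ≤ ∑ j ∈ F, ∫ p : X × ℝ, c ^ 2 * e j p.1 ^ 2 ∂ρ := by
          refine Finset.sum_le_sum fun j _ => integral_mono_of_nonneg
            (Eventually.of_forall fun _ => sq_nonneg _) (hint _) ?_
          filter_upwards [hc] with p hp
          exact residualMul_sq_le hp _
      _ = ∫ p : X × ℝ, ∑ j ∈ F, c ^ 2 * e j p.1 ^ 2 ∂ρ :=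
          (integral_finsetSum _ fun j _ => hint _).symm
      _ ≤ ∫ _ : X × ℝ, (c * B) ^ 2 ∂ρ := by
          refine integral_mono (integrable_finsetSum _ fun j _ => hint _) (integrable_const _)
            fun p => ?_
          rw [← Finset.mul_sum, mul_pow]
          exact mul_le_mul_of_nonneg_left (sum_basis_sq_le e hB p.1 F) (sq_nonneg c)
      _ = _ := by simp

lemma lintegral_sqDev_testFn_mul_basis_le (hz : ∀ t, Measurable (z t))
    (hρ : ∀ t, P.map (z t) = ρ) (hlam : 0 < lam) (hB0 : 0 < B)
    (hB : ∀ x : X, ‖representer H x‖ ≤ B)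
    (hN : ∀ F : Finset ι, ∑ k ∈ F, ‖inclusion hH ρ.fst (testFn hH ρ lam (b k))‖ ^ 2 ≤ N)
    {n : ℕ} (hn : 1 ≤ n) :
    ∫⁻ ω, sqDev ρ (fun t => z t ω) n (fun (q : ι × κ) (p : X × ℝ) =>
        testFn hH ρ lam (b q.1) p.1 * e q.2 p.1) ∂P ≤
      ENNReal.ofReal ((1 / (n : ℝ)) * (B ^ 2 * N +
        784 * (B ^ 2 / lam * B ^ 2) * ∑ l ∈ Finset.Icc 1 n, alphaMixing P z l)) := by
  classical
  have e1 : B ^ 2 / lam * B ^ 2 = (B * B / √lam) ^ 2 := by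
    rw [div_pow, Real.sq_sqrt hlam.le]; ring
  -- A finite index set is enlarged to the product of its projections, over which the sum of squares
  -- factorises.
  have hsub : ∀ F : Finset (ι × κ), F ⊆ F.image Prod.fst ×ˢ F.image Prod.snd := fun F =>
    Finset.subset_product
  have hpt : ∀ (F : Finset (ι × κ)) (x : X),
      ∑ q ∈ F, (testFn hH ρ lam (b q.1) x * e q.2 x) ^ 2 ≤
        (∑ k ∈ F.image Prod.fst, testFn hH ρ lam (b k) x ^ 2) * B ^ 2 := fun F x => by
    calc _ ≤ ∑ q ∈ F.image Prod.fst ×ˢ F.image Prod.snd,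
          (testFn hH ρ lam (b q.1) x * e q.2 x) ^ 2 :=
          Finset.sum_le_sum_of_subset_of_nonneg (hsub F) fun _ _ _ => sq_nonneg _
      _ = (∑ k ∈ F.image Prod.fst, testFn hH ρ lam (b k) x ^ 2) *
          ∑ j ∈ F.image Prod.snd, e j x ^ 2 := by
          simp_rw [mul_pow]
          rw [Finset.sum_product, Finset.sum_mul_sum]
      _ ≤ _ := mul_le_mul_of_nonneg_left (sum_basis_sq_le e hB x _)
          (Finset.sum_nonneg fun _ _ => sq_nonneg _)
  have hprod : ∀ q : ι × κ, Integrable (fun p : X × ℝ =>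
      (testFn hH ρ lam (b q.1) p.1 * e q.2 p.1) ^ 2) ρ := fun q => by
    refine Integrable.mono' ((integrable_rkhs_sq ρ hH (testFn hH ρ lam (b q.1))).mul_const (B ^ 2))
      (((measurable_rkhs hH _).mul (measurable_rkhs hH _)).pow_const 2).aestronglyMeasurable
      (Eventually.of_forall fun p => ?_)
    rw [Real.norm_of_nonneg (sq_nonneg _)]
    simpa using hpt {q} p.1
  rw [e1]
  refine lintegral_tsum_sq_empirical_le hz hρ
    (fun q => (measurable_rkhs hH _).mul (measurable_rkhs hH _)) (by positivity)
    (Eventually.of_forall fun p F => ?_) (fun F => ?_) hn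
  · rw [← e1]
    exact (hpt F p.1).trans (mul_le_mul_of_nonneg_right (sum_testFn_sq_le hH ρ b hlam hB p.1 _)
      (sq_nonneg B))
  · simp only [Pi.mul_apply]
    rw [← integral_finsetSum _ fun q _ => hprod q]
    calc _ ≤ ∫ p : X × ℝ, (∑ k ∈ F.image Prod.fst, testFn hH ρ lam (b k) p.1 ^ 2) * B ^ 2 ∂ρ :=
          integral_mono (integrable_finsetSum _ fun q _ => hprod q)
            ((integrable_finsetSum _ fun k _ => integrable_rkhs_sq ρ hH _).mul_const _)
            fun p => hpt F p.1
      _ = (∑ k ∈ F.image Prod.fst, ‖inclusion hH ρ.fst (testFn hH ρ lam (b k))‖ ^ 2) * B ^ 2 := by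
          rw [integral_mul_const, integral_finsetSum _ fun k _ => integrable_rkhs_sq ρ hH _]
          simp_rw [integral_rkhs_sq hH]
      _ ≤ _ := by
          rw [mul_comm]
          exact mul_le_mul_of_nonneg_left (hN _) (sq_nonneg B)

end ExpectedError

/-! ### Choice of the regularization parameter and comparison of exponents. -/

section Rates

/-- Says that `lam ^ (s - 1)`, the excess of `1 / lam` over `lam ^ (-s)`, is absorbed by the square
of the power of `n` in the final bound. -/
lemma rate_exponent_ge {r s δ : ℝ} (hs₀ : 0 < s) (hr₀ : 1 / 2 ≤ r) (hδ : 0 < δ) :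
    (1 - s) / (2 * r + s) ≤
      2 * ((2 * s + δ + 2 * δ * r + 4 * r) / ((2 * r + s) * (2 * δ + 4))) := by
  have h1 : 0 < 2 * r + s := by linarith
  have h2 : 0 < 2 * δ + 4 := by linarith
  rw [← mul_div_assoc, div_le_div_iff₀ h1 (by positivity)]
  have h3 : (1 - s) * (2 * δ + 4) ≤ 2 * (2 * s + δ + 2 * δ * r + 4 * r) := by
    nlinarith [mul_pos hδ hs₀, mul_nonneg hδ.le (by linarith : 0 ≤ r)]
  calc (1 - s) * ((2 * r + s) * (2 * δ + 4)) = (1 - s) * (2 * δ + 4) * (2 * r + s) := by ring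
    _ ≤ _ := mul_le_mul_of_nonneg_right h3 h1.le

/-- Since `α ≤ 1` and `2 θ ≤ 1`, `α ≤ (α ^ θ)²`; a sum of squares of nonnegative terms is at most
the square of their sum. -/
lemma sum_le_sq_sum {ι : Type*} (S : Finset ι) {α : ι → ℝ} (h0 : ∀ l, 0 ≤ α l) {θ : ℝ}
    (h1 : ∀ l, α l ≤ 1) (hθ : θ ≤ 1 / 2) :
    ∑ l ∈ S, α l ≤ (∑ l ∈ S, α l ^ θ) ^ 2 := by
  calc ∑ l ∈ S, α l ≤ ∑ l ∈ S, (α l ^ θ) ^ 2 := by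
        refine Finset.sum_le_sum fun l _ => ?_
        rw [← Real.rpow_natCast, ← Real.rpow_mul (h0 l)]
        rcases (h0 l).eq_or_lt with h | h
        · rw [← h]; positivity
        · calc α l = α l ^ (1 : ℝ) := (Real.rpow_one _).symm
            _ ≤ _ := Real.rpow_le_rpow_of_exponent_ge h (h1 l) (by push_cast; linarith)
    _ ≤ _ := Finset.sum_sq_le_sq_sum_of_nonneg fun l _ => Real.rpow_nonneg (h0 l) θ

/-- The variance terms, evaluated at `lam = n ^ (-1 / (2 r + s))`, have the stated order. -/
lemma rate_bound {r s δ : ℝ} (hs₀ : 0 < s) (hr₀ : 1 / 2 ≤ r) (hrs : 2 ≤ 2 * r + s)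
    (hδ : 0 < δ) {α : ℕ → ℝ} (h0 : ∀ l, 0 ≤ α l) (h1 : ∀ l, α l ≤ 1) {n : ℕ} (hn : 1 ≤ n)
    {G h : ℝ} (hG : 0 ≤ G) (hh : 0 ≤ h) {p q d : ℝ}
    (hp : p ≤ 1 / (n : ℝ) * (G * (((n : ℝ) ^ (-1 / (2 * r + s))) ^ (-s) +
      ((n : ℝ) ^ (-1 / (2 * r + s)))⁻¹ * ∑ l ∈ Finset.Icc 1 n, α l)))
    (hq : q ≤ 1 / (n : ℝ) * (G * (((n : ℝ) ^ (-1 / (2 * r + s))) ^ (-s) +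
      ((n : ℝ) ^ (-1 / (2 * r + s)))⁻¹ * ∑ l ∈ Finset.Icc 1 n, α l)))
    (hd : d ≤ 1 / (n : ℝ) * (G * (1 + ∑ l ∈ Finset.Icc 1 n, α l))) :
    √p + ((n : ℝ) ^ (-1 / (2 * r + s)))⁻¹ * (√q * √d) + ((n : ℝ) ^ (-1 / (2 * r + s))) ^ r * h ≤
      (√G + G + h + 1) * (n : ℝ) ^ (-r / (2 * r + s)) *
        (1 + ∑ l ∈ Finset.Icc 1 n, √(α l)) *
        (1 + (n : ℝ) ^ ((2 * s + δ + 2 * δ * r + 4 * r) / ((2 * r + s) * (2 * δ + 4))) *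
          ∑ l ∈ Finset.Icc 1 n, α l ^ (δ / (4 + 2 * δ))) := by
  set lam : ℝ := (n : ℝ) ^ (-1 / (2 * r + s)) with hlam
  set E : ℝ := (2 * s + δ + 2 * δ * r + 4 * r) / ((2 * r + s) * (2 * δ + 4)) with hE
  set σ : ℝ := ∑ l ∈ Finset.Icc 1 n, α l with hσ
  set T : ℝ := ∑ l ∈ Finset.Icc 1 n, α l ^ (δ / (4 + 2 * δ)) with hT
  set S : ℝ := ∑ l ∈ Finset.Icc 1 n, √(α l) with hS
  have ha : 0 < 2 * r + s := by linarith
  have hn1 : (1 : ℝ) ≤ n := by exact_mod_cast hn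
  have hn0 : (0 : ℝ) < n := by linarith
  have hlam0 : 0 < lam := Real.rpow_pos_of_pos hn0 _
  have hσ0 : 0 ≤ σ := Finset.sum_nonneg fun l _ => h0 l
  have hT0 : 0 ≤ T := Finset.sum_nonneg fun l _ => Real.rpow_nonneg (h0 l) _
  have hS0 : 0 ≤ S := Finset.sum_nonneg fun l _ => Real.sqrt_nonneg _
  have hσT : σ ≤ T ^ 2 := sum_le_sq_sum _ h0 h1 (by
    rw [div_le_div_iff₀ (by positivity) (by norm_num)]; linarith)
  have hσS : σ ≤ S ^ 2 := by
    have := sum_le_sq_sum (Finset.Icc 1 n) h0 h1 (θ := 1 / 2) le_rfl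
    simpa only [← Real.sqrt_eq_rpow] using this
  have hpow : ∀ x : ℝ, lam ^ x = (n : ℝ) ^ (-x / (2 * r + s)) := fun x => by
    rw [hlam, ← Real.rpow_mul hn0.le]
    ring_nf
  have hlr : (n : ℝ) ^ (-r / (2 * r + s)) = lam ^ r := (hpow r).symm
  have hninv : 1 / (n : ℝ) = lam ^ (2 * r + s) := by
    rw [hpow, neg_div, div_self ha.ne', Real.rpow_neg_one, one_div]
  have hL : 0 < lam ^ r := Real.rpow_pos_of_pos hlam0 r
  -- By `1 / n = lam ^ (2r + s)`, the effective-dimension part is exactly `lam ^ (2r)` and the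
  -- mixing part carries an additional `lam ^ (s - 1) * σ`.
  have hW : 1 / (n : ℝ) * (lam ^ (-s) + lam⁻¹ * σ) ≤ (lam ^ r * (1 + (n : ℝ) ^ E * T)) ^ 2 := by
    have e1 : 1 / (n : ℝ) * lam ^ (-s) = (lam ^ r) ^ 2 := by
      rw [hninv, ← Real.rpow_add hlam0, sq, ← Real.rpow_add hlam0]
      ring_nf
    have e2 : 1 / (n : ℝ) * lam⁻¹ = (lam ^ r) ^ 2 * lam ^ (s - 1) := by
      rw [← Real.rpow_neg_one lam, hninv, ← Real.rpow_add hlam0, sq, ← Real.rpow_add hlam0,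
        ← Real.rpow_add hlam0]
      ring_nf
    have e3 : lam ^ (s - 1) ≤ ((n : ℝ) ^ E) ^ 2 := by
      rw [hpow, ← Real.rpow_natCast, ← Real.rpow_mul hn0.le]
      refine Real.rpow_le_rpow_of_exponent_le hn1 ?_
      have := rate_exponent_ge hs₀ hr₀ hδ
      rw [← hE] at this
      push_cast
      rw [neg_sub]
      linarith
    have e4 : lam ^ (s - 1) * σ ≤ ((n : ℝ) ^ E * T) ^ 2 := by
      rw [mul_pow]
      exact mul_le_mul e3 hσT hσ0 (sq_nonneg _)
    have e5 : 0 ≤ (n : ℝ) ^ E * T := by positivity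
    calc _ = (lam ^ r) ^ 2 * (1 + lam ^ (s - 1) * σ) := by
          rw [mul_add, e1, ← mul_assoc, e2]; ring
      _ ≤ (lam ^ r) ^ 2 * (1 + (n : ℝ) ^ E * T) ^ 2 :=
          mul_le_mul_of_nonneg_left (by nlinarith) (sq_nonneg _)
      _ = _ := (mul_pow _ _ _).symm
  set Y : ℝ := 1 + (n : ℝ) ^ E * T with hY
  have hY1 : 1 ≤ Y := by
    have : 0 ≤ (n : ℝ) ^ E * T := by positivity
    linarith
  have key : ∀ x : ℝ, x ≤ 1 / (n : ℝ) * (G * (lam ^ (-s) + lam⁻¹ * σ)) →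
      √x ≤ √G * (lam ^ r * Y) := fun x hx => by
    rw [Real.sqrt_le_left (by positivity), mul_pow, Real.sq_sqrt hG]
    refine hx.trans ?_
    calc _ = G * (1 / (n : ℝ) * (lam ^ (-s) + lam⁻¹ * σ)) := by ring
      _ ≤ _ := mul_le_mul_of_nonneg_left hW hG
  -- The loss `1 / lam` from bounding the `H`-norm of the sampling error is compensated by `1 / n ≤
  -- lam²`, which is where `2r + s ≥ 2` is needed.
  have hdd : lam⁻¹ * √d ≤ √G * (1 + S) := by
    have e1 : √d ≤ lam * (√G * (1 + S)) := by
      rw [Real.sqrt_le_left (by positivity), mul_pow, mul_pow, Real.sq_sqrt hG]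
      have e2 : 1 / (n : ℝ) ≤ lam ^ 2 := by
        rw [← Real.rpow_natCast, hpow, one_div, ← Real.rpow_neg_one]
        refine Real.rpow_le_rpow_of_exponent_le hn1 ?_
        rw [le_div_iff₀ ha]
        push_cast
        linarith
      have e3 : 1 + σ ≤ (1 + S) ^ 2 := by nlinarith
      refine hd.trans (mul_le_mul e2 (mul_le_mul_of_nonneg_left e3 hG) (by positivity)
        (by positivity))
    rwa [inv_mul_eq_div, div_le_iff₀ hlam0, mul_comm]
  rw [hlr]
  have t1 := key p hp
  have t2 : lam⁻¹ * (√q * √d) ≤ G * (lam ^ r * Y * (1 + S)) := by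
    calc lam⁻¹ * (√q * √d) = √q * (lam⁻¹ * √d) := by ring
      _ ≤ (√G * (lam ^ r * Y)) * (√G * (1 + S)) :=
          mul_le_mul (key q hq) hdd (by positivity) (by positivity)
      _ = (√G * √G) * (lam ^ r * Y * (1 + S)) := by ring
      _ = _ := by rw [Real.mul_self_sqrt hG]
  have t3 : lam ^ r * Y ≤ lam ^ r * Y * (1 + S) :=
    le_mul_of_one_le_right (by positivity) (by linarith)
  have t4 : lam ^ r ≤ lam ^ r * Y * (1 + S) :=
    (le_mul_of_one_le_right hL.le hY1).trans t3
  have t5 := mul_le_mul_of_nonneg_left t3 (Real.sqrt_nonneg G)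
  have t6 := mul_le_mul_of_nonneg_right t4 hh
  calc _ ≤ √G * (lam ^ r * Y * (1 + S)) + G * (lam ^ r * Y * (1 + S)) +
        lam ^ r * Y * (1 + S) * h := by linarith
    _ ≤ √G * (lam ^ r * Y * (1 + S)) + G * (lam ^ r * Y * (1 + S)) +
        lam ^ r * Y * (1 + S) * h + lam ^ r * Y * (1 + S) :=
        le_add_of_nonneg_right (by positivity)
    _ = _ := by ring

end Rates

/-! ### Assembly of the error bound. -/

section Main

variable {X : Type*} [MetricSpace X] [CompactSpace X] [MeasurableSpace X] [BorelSpace X]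
  {K : C(X × X, ℝ)} {H : Type*} [NormedAddCommGroup H] [InnerProductSpace ℝ H] [CompleteSpace H]
  [RKHS ℝ H X ℝ] (ρ : Measure (X × ℝ)) [IsProbabilityMeasure ρ]

lemma eLpNorm_sub_regressionFn (hH : ∀ x y : X, RKHS.kernel H x y 1 = K (x, y))
    {f : Lp ℝ 2 ρ.fst} (hf : regressionFn ρ =ᵐ[ρ.fst] f) (g : H) :
    eLpNorm (fun x => g x - regressionFn ρ x) 2 ρ.fst =
      ENNReal.ofReal ‖inclusion hH ρ.fst g - f‖ := by
  rw [ofReal_norm, Lp.enorm_def]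
  refine eLpNorm_congr_ae ?_
  filter_upwards [hf, coeFn_inclusion hH ρ.fst g, Lp.coeFn_sub (inclusion hH ρ.fst g) f]
    with x h1 h2 h3
  rw [h3, Pi.sub_apply, h1, h2]

lemma integralOpPow_eq (hH : ∀ x y : X, RKHS.kernel H x y 1 = K (x, y))
    (hK : IsMercerKernel K) (μ : Measure X) [IsFiniteMeasure μ] (r : ℝ) (h : Lp ℝ 2 μ) :
    integralOpPow K μ r h = ∑' t : ℝ, t ^ r • eigenPart (inclusion hH μ) t h := by
  simp only [integralOpPow, eigenPart, integralOp_eq hH μ hK]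

lemma aemeasurable_eLpNorm_krr_sub (hH : ∀ x y : X, RKHS.kernel H x y 1 = K (x, y))
    {f : Lp ℝ 2 ρ.fst} (hf : regressionFn ρ =ᵐ[ρ.fst] f)
    {Ω : Type*} [MeasurableSpace Ω] (P : Measure Ω) {z : ℕ → Ω → X × ℝ}
    (hz : ∀ t, Measurable (z t)) (n : ℕ) {lam : ℝ} (hlam : 0 < lam) :
    AEMeasurable (fun ω => eLpNorm
      (fun x => krr H (fun i : Fin n => z i ω) lam x - regressionFn ρ x) 2 ρ.fst) P := by
  simp_rw [eLpNorm_sub_regressionFn ρ hH hf]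
  have hc : Continuous fun D : Fin n → X × ℝ => ‖inclusion hH ρ.fst (krr H D lam) - f‖ :=
    (((inclusion hH ρ.fst).continuous.comp (continuous_krr hH hlam)).sub continuous_const).norm
  have hD : Measurable fun ω => fun i : Fin n => z i ω := measurable_pi_lambda _ fun i => hz i
  exact (hc.measurable.comp hD).ennreal_ofReal.aemeasurable

/-- Expected error bound at a fixed regularization parameter. -/
lemma lintegral_eLpNorm_krr_sub_le (hH : ∀ x y : X, RKHS.kernel H x y 1 = K (x, y))
    (hK : IsMercerKernel K) {M : ℝ} (hM : 0 < M)
    (hy : ∀ᵐ p ∂ρ, |p.2| ≤ M) {r : ℝ} (hr₀ : 1 / 2 ≤ r) (hr₁ : r ≤ 1) {h : Lp ℝ 2 ρ.fst}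
    (hh : regressionFn ρ =ᵐ[ρ.fst] integralOpPow K ρ.fst r h) :
    ∃ B c : ℝ, ∀ {Ω : Type*} [MeasurableSpace Ω] (P : Measure Ω) [IsProbabilityMeasure P]
      (z : ℕ → Ω → X × ℝ), (∀ t, Measurable (z t)) → (∀ t, P.map (z t) = ρ) →
      ∀ (n : ℕ) (lam N : ℝ), 1 ≤ n → 0 < lam → 0 ≤ N →
        effectiveDim K ρ.fst lam ≤ ENNReal.ofReal N →
        ∫⁻ ω, eLpNorm (fun x => krr H (fun i : Fin n => z i ω) lam x - regressionFn ρ x)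
            2 ρ.fst ∂P ≤
          ENNReal.ofReal
            (√((1 / (n : ℝ)) * (c ^ 2 * N +
              784 * (c ^ 2 * (B ^ 2 / lam)) * ∑ l ∈ Finset.Icc 1 n, alphaMixing P z l)) +
            lam⁻¹ * (√((1 / (n : ℝ)) * (B ^ 2 * N +
              784 * (B ^ 2 / lam * B ^ 2) * ∑ l ∈ Finset.Icc 1 n, alphaMixing P z l)) *
            √((1 / (n : ℝ)) * (c ^ 2 * B ^ 2 +
              784 * (c ^ 2 * B ^ 2) * ∑ l ∈ Finset.Icc 1 n, alphaMixing P z l))) +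
            lam ^ r * ‖h‖) := by
  obtain ⟨B, hB0, hB⟩ := exists_norm_representer_le hH
  set I := inclusion hH ρ.fst with hI
  refine ⟨B, M + B * ((1 + ‖I ∘L adjoint I‖) * ‖h‖), ?_⟩
  intro Ω _ P _ z hz hρ n lam N hn hlam hN0 hN
  set c := M + B * ((1 + ‖I ∘L adjoint I‖) * ‖h‖) with hc
  have hc0 : 0 < c := by positivity
  set f := integralOpPow K ρ.fst r h with hf
  have hfe : f = ∑' t : ℝ, t ^ r • eigenPart I t h := integralOpPow_eq hH hK ρ.fst r h
  set g := popReg hH ρ lam f with hg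
  have hbias : ‖I g - f‖ ≤ lam ^ r * ‖h‖ := by
    rw [norm_sub_rev, hg, sub_inclusion_popReg hH ρ hlam, hfe]
    exact norm_smul_regInv_tsum_le I hlam (by linarith) hr₁ h
  have hgn : ‖g‖ ≤ (1 + ‖I ∘L adjoint I‖) * ‖h‖ := by
    rw [hg, popReg, hfe]
    exact norm_adjoint_regInv_tsum_le I hlam hr₀ hr₁ h
  -- The bound `c` depends neither on `lam` nor on `n`, so the final constant is independent of the
  -- sample size.
  have hres : ∀ᵐ p ∂ρ, |p.2 - g p.1| ≤ c := by
    filter_upwards [hy] with p hp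
    refine (abs_sub _ _).trans (add_le_add hp ((abs_apply_le hB g p.1).trans ?_))
    exact mul_le_mul_of_nonneg_left hgn hB0.le
  -- This is the very basis chosen in `trace`, so the hypothesis on `effectiveDim` applies without
  -- proving basis independence.
  obtain ⟨b, hb⟩ := (exists_hilbertBasis ℝ (Lp ℝ 2 ρ.fst)).choose_spec
  obtain ⟨w, e, -⟩ := exists_hilbertBasis ℝ H
  have := countable_basis_Lp ρ.fst b
  have := countable_basis_rkhs hH e
  have hdim := sum_norm_inclusion_testFn_sq_le hH ρ b hlam hK hN0 (by
    rw [hb]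
    exact hN)
  have hp := lintegral_sqDev_residual_testFn_le hH ρ b hz hρ hlam hB0 hB hc0 hres hdim hn
  have hq := lintegral_sqDev_testFn_mul_basis_le hH ρ b e hz hρ hlam hB0 hB hdim hn
  have hd := lintegral_sqDev_residual_basis_le ρ e hH hz hρ hB0 hB hc0 hres hn
  have mp := measurable_sqDev ρ hz n
    (fun k => measurable_residualMul hH g (testFn hH ρ lam (b k)))
  have md := measurable_sqDev ρ hz n (fun j => measurable_residualMul hH g (e j))
  have mq := measurable_sqDev ρ hz n (φ := fun (q : _ × _) (p : X × ℝ) =>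
    testFn hH ρ lam (b q.1) p.1 * e q.2 p.1)
    (fun q => (measurable_rkhs hH _).mul (measurable_rkhs hH _))
  have hα : 0 ≤ ∑ l ∈ Finset.Icc 1 n, alphaMixing P z l :=
    Finset.sum_nonneg fun l _ => alphaMixing_nonneg z l
  have hsqrt : ∀ {x : ℝ}, 0 ≤ x → ENNReal.ofReal x ^ (1 / 2 : ℝ) = ENNReal.ofReal √x := fun hx => by
    rw [ENNReal.ofReal_rpow_of_nonneg hx (by norm_num), Real.sqrt_eq_rpow]
  simp_rw [eLpNorm_sub_regressionFn ρ hH hh]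
  calc ∫⁻ ω, ENNReal.ofReal ‖I (krr H (fun i : Fin n => z i ω) lam) - f‖ ∂P
      ≤ ∫⁻ ω, (sqDev ρ (fun t => z t ω) n
            (fun k => residualMul g (testFn hH ρ lam (b k))) ^ (1 / 2 : ℝ) +
          (ENNReal.ofReal lam⁻¹ * (sqDev ρ (fun t => z t ω) n (fun (q : _ × _) (p : X × ℝ) =>
            testFn hH ρ lam (b q.1) p.1 * e q.2 p.1) ^ (1 / 2 : ℝ) *
          sqDev ρ (fun t => z t ω) n (fun j => residualMul g (e j)) ^ (1 / 2 : ℝ)) +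
          ENNReal.ofReal (lam ^ r * ‖h‖))) ∂P := by
        refine lintegral_mono fun ω => ?_
        rw [← add_assoc]
        refine le_trans ?_ (add_le_add (ofReal_norm_inclusion_krr_sub_le hH ρ b e hlam hy hh
          (fun t => z t ω) n) (ENNReal.ofReal_le_ofReal hbias))
        rw [← ENNReal.ofReal_add (norm_nonneg _) (norm_nonneg _)]
        refine ENNReal.ofReal_le_ofReal ?_
        rw [map_sub]
        exact norm_sub_le_norm_sub_add_norm_sub _ _ _
    _ = ∫⁻ ω, sqDev ρ (fun t => z t ω) n
            (fun k => residualMul g (testFn hH ρ lam (b k))) ^ (1 / 2 : ℝ) ∂P +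
          (ENNReal.ofReal lam⁻¹ * (∫⁻ ω, sqDev ρ (fun t => z t ω) n
            (fun (q : _ × _) (p : X × ℝ) =>
            testFn hH ρ lam (b q.1) p.1 * e q.2 p.1) ^ (1 / 2 : ℝ) *
          sqDev ρ (fun t => z t ω) n (fun j => residualMul g (e j)) ^ (1 / 2 : ℝ) ∂P) +
          ENNReal.ofReal (lam ^ r * ‖h‖)) := by
        rw [lintegral_add_left (mp.pow_const _), lintegral_add_right _ measurable_const,
          lintegral_const_mul' _ _ ENNReal.ofReal_ne_top]
        simp
    _ ≤ _ := by
        rw [ENNReal.ofReal_add (by positivity) (by positivity),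
          ENNReal.ofReal_add (by positivity) (by positivity),
          ENNReal.ofReal_mul (inv_nonneg.2 hlam.le), ENNReal.ofReal_mul (Real.sqrt_nonneg _),
          ← hsqrt (by positivity), ← hsqrt (by positivity), ← hsqrt (by positivity), add_assoc]
        refine add_le_add ((lintegral_sqrt_le mp).trans (ENNReal.rpow_le_rpow hp (by norm_num)))
          (add_le_add (mul_le_mul_right ?_ _) le_rfl)
        refine (lintegral_sqrt_mul_sqrt_le mq md).trans ?_
        exact mul_le_mul' (ENNReal.rpow_le_rpow hq (by norm_num))
          (ENNReal.rpow_le_rpow hd (by norm_num))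

end Main

end

end KRRMixing

theorem theorem2
    {X : Type*} [MetricSpace X] [CompactSpace X] [MeasurableSpace X] [BorelSpace X]
    (K : C(X × X, ℝ)) (hK : KRRMixing.IsMercerKernel K)
    {H : Type*} [NormedAddCommGroup H] [InnerProductSpace ℝ H] [CompleteSpace H]
    [RKHS ℝ H X ℝ] (hH : ∀ x y : X, RKHS.kernel H x y 1 = K (x, y))
    (ρ : Measure (X × ℝ)) [IsProbabilityMeasure ρ]
    (M : ℝ) (hM : 0 < M) (hy : ∀ᵐ p ∂ρ, |p.2| ≤ M)
    (s : ℝ) (hs₀ : 0 < s) (hs₁ : s ≤ 1) (C₀ : ℝ) (hC₀ : 1 ≤ C₀)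
    (hN : ∀ lam : ℝ, 0 < lam →
      KRRMixing.effectiveDim K ρ.fst lam ≤ ENNReal.ofReal (C₀ * lam ^ (-s)))
    (r : ℝ) (hr₀ : 1 / 2 ≤ r) (hr₁ : r ≤ 1)
    (hreg : ∃ h : Lp ℝ 2 ρ.fst,
      KRRMixing.regressionFn ρ =ᵐ[ρ.fst] KRRMixing.integralOpPow K ρ.fst r h)
    (hrs : 2 ≤ 2 * r + s) (δ : ℝ) (hδ : 0 < δ) :
    ∃ C : ℝ, 0 < C ∧
      ∀ {Ω : Type*} [MeasurableSpace Ω] (P : Measure Ω) [IsProbabilityMeasure P]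
        (z : ℕ → Ω → X × ℝ),
        (∀ t, Measurable (z t)) → (∀ t, P.map (z t) = ρ) →
        KRRMixing.IsStationary P z → KRRMixing.IsStrongMixing P z →
        ∀ n : ℕ, 1 ≤ n →
          AEMeasurable (fun ω => eLpNorm
            (fun x => KRRMixing.krr H (fun i : Fin n => z i ω)
              ((n : ℝ) ^ (-1 / (2 * r + s))) x - KRRMixing.regressionFn ρ x) 2 ρ.fst) P ∧
          ∫⁻ ω, eLpNorm
            (fun x => KRRMixing.krr H (fun i : Fin n => z i ω)
              ((n : ℝ) ^ (-1 / (2 * r + s))) x - KRRMixing.regressionFn ρ x) 2 ρ.fst ∂P ≤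
            ENNReal.ofReal
              (C * (n : ℝ) ^ (-r / (2 * r + s)) *
                (1 + ∑ l ∈ Finset.Icc 1 n, √(KRRMixing.alphaMixing P z l)) *
                (1 + (n : ℝ) ^ ((2 * s + δ + 2 * δ * r + 4 * r) /
                      ((2 * r + s) * (2 * δ + 4))) *
                    ∑ l ∈ Finset.Icc 1 n,
                      (KRRMixing.alphaMixing P z l) ^ (δ / (4 + 2 * δ)))) := by
  obtain ⟨h, hh⟩ := hreg
  obtain ⟨B, c, hmain⟩ := KRRMixing.lintegral_eLpNorm_krr_sub_le ρ hH hK hM hy hr₀ hr₁ hh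
  -- A single constant dominating all coefficients in the three variance bounds; 784 is twice the
  -- covariance constant 392.
  set G : ℝ := c ^ 2 * C₀ + B ^ 2 * C₀ + 784 * (c ^ 2 * B ^ 2 + B ^ 2 * B ^ 2) with hG
  have hG0 : 0 ≤ G := by positivity
  refine ⟨√G + G + ‖h‖ + 1, by positivity, ?_⟩
  intro Ω _ P _ z hz hρ _ _ n hn
  have hn0 : (0 : ℝ) < n := by exact_mod_cast hn
  set lam : ℝ := (n : ℝ) ^ (-1 / (2 * r + s)) with hlam
  have hlam0 : 0 < lam := Real.rpow_pos_of_pos hn0 _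
  refine ⟨KRRMixing.aemeasurable_eLpNorm_krr_sub ρ hH hh P hz n hlam0, ?_⟩
  have hls : 0 < lam ^ (-s) := Real.rpow_pos_of_pos hlam0 _
  refine (hmain P z hz hρ n lam (C₀ * lam ^ (-s)) hn hlam0 (by positivity) (hN lam hlam0)).trans ?_
  refine ENNReal.ofReal_le_ofReal ?_
  have hσ : 0 ≤ ∑ l ∈ Finset.Icc 1 n, KRRMixing.alphaMixing P z l :=
    Finset.sum_nonneg fun l _ => KRRMixing.alphaMixing_nonneg z l
  set σ := ∑ l ∈ Finset.Icc 1 n, KRRMixing.alphaMixing P z l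
  have hcoef : ∀ A D u v : ℝ, A ≤ G → D ≤ G → 0 ≤ u → 0 ≤ v →
      1 / (n : ℝ) * (A * u + D * v) ≤ 1 / (n : ℝ) * (G * (u + v)) := fun A D u v hA hD hu hv => by
    refine mul_le_mul_of_nonneg_left ?_ (by positivity)
    rw [mul_add]
    exact add_le_add (mul_le_mul_of_nonneg_right hA hu) (mul_le_mul_of_nonneg_right hD hv)
  have hc1 : 0 ≤ c ^ 2 * C₀ := by positivity
  have hc2 : 0 ≤ B ^ 2 * C₀ := by positivity
  have hc3 : 0 ≤ c ^ 2 * B ^ 2 := by positivity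
  have hc4 : 0 ≤ B ^ 2 * B ^ 2 := by positivity
  have g1 : c ^ 2 * C₀ ≤ G := by linarith
  have g2 : B ^ 2 * C₀ ≤ G := by linarith
  have g3 : 784 * (c ^ 2 * B ^ 2) ≤ G := by linarith
  have g4 : 784 * (B ^ 2 * B ^ 2) ≤ G := by linarith
  have hls' : 0 ≤ lam⁻¹ * σ := by positivity
  have hp : 1 / (n : ℝ) * (c ^ 2 * (C₀ * lam ^ (-s)) + 784 * (c ^ 2 * (B ^ 2 / lam)) * σ) ≤
      1 / (n : ℝ) * (G * (lam ^ (-s) + lam⁻¹ * σ)) :=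
    le_trans (le_of_eq (by ring)) (hcoef _ _ _ _ g1 g3 hls.le hls')
  have hq : 1 / (n : ℝ) * (B ^ 2 * (C₀ * lam ^ (-s)) + 784 * (B ^ 2 / lam * B ^ 2) * σ) ≤
      1 / (n : ℝ) * (G * (lam ^ (-s) + lam⁻¹ * σ)) :=
    le_trans (le_of_eq (by ring)) (hcoef _ _ _ _ g2 g4 hls.le hls')
  have hd : 1 / (n : ℝ) * (c ^ 2 * B ^ 2 + 784 * (c ^ 2 * B ^ 2) * σ) ≤
      1 / (n : ℝ) * (G * (1 + σ)) :=
    le_trans (le_of_eq (by ring)) (hcoef (c ^ 2 * B ^ 2) _ 1 σ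
      (by linarith [mul_nonneg (sq_nonneg c) (sq_nonneg B)]) g3 zero_le_one hσ)
  exact KRRMixing.rate_bound hs₀ hr₀ hrs hδ (KRRMixing.alphaMixing_nonneg z)
    (KRRMixing.alphaMixing_le_one z) hn hG0 (norm_nonneg h) hp hq hd
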